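/- Let $k\in\mathbb{N}$ and let $\Lambda$ be a nonempty row-finite $k$-graph without sources: a small category with a degree functor $d:\Lambda\to\mathbb{N}^k$ having the unique factorisation property, such that for every vertex $v$ and $n\in\mathbb{N}^k$ the set $v\Lambda^n$ of paths with range $v$ and degree $n$ is finite and nonempty. Suppose that * $\Lambda$ is aperiodic: for every vertex $v$ and all $m\neq n$ in $\mathbb{N}^k$ there is a path $\lambda$ with range $v$ such that $d(\lambda)\geq m\vee n$ and $\lambda(m,m+d(\lambda)-(m\vee n))\neq\lambda(n,n+d(\lambda)-(m\vee n))$, where $\lambda(p,q)$ is the segment $\lambda''$ in the factorisation $\lambda=\lambda'\lambda''\lambda'''$ with $d(\lambda')=p$, $d(\lambda'')=q-p$; * $\Lambda$ is cofinal: for all vertices $v,w$ there is $n\in\mathbb{N}^k$ such that for every $\lambda\in w\Lambda^n$ there is a path with range $v$ and source $s(\lambda)$. Let $\eta:\Lambda\to G$ be a functor into a (discrete) group $G$, and let $\sigma\in Z^2(G,\mathbb{T})$, that is, $\sigma:G\times G\to\mathbb{T}$ satisfies $\sigma(e,g)=\sigma(g,e)=1$ and $\sigma(g,h)\sigma(gh,l)=\sigma(g,hl)\sigma(h,l)$.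 Let $C^*(\Lambda)$ be the universal $C^*$-algebra generated by a Cuntz–Krieger $\Lambda$-family $\{s_\lambda\}$, and let $B$ be the Fell bundle over $G$ with fibres $$B_g=\overline{\operatorname{span}}\{s_\lambda s_\mu^*:\eta(\lambda)\eta(\mu)^{-1}=g\}\subset C^*(\Lambda)$$ and operations inherited from $C^*(\Lambda)$. Let $B(\sigma)$ be the Fell bundle with the same fibres and the operations $b\cdot_\sigma c=\sigma(g,h)\,bc$ and $b^{*_\sigma}=\overline{\sigma(g,g^{-1})}\,b^*$ for $b\in B_g$, $c\in B_h$, and let $C^*(B(\sigma))$ be the $C^*$-algebra generated by a universal representation of $B(\sigma)$. Then $C^*(B(\sigma))$ is simple: it is nonzero, and its only closed two-sided ideals are $0$ and $C^*(B(\sigma))$. -/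

import Mathlib

open CategoryTheory
open scoped ENNReal ComplexConjugate

universe u v w

noncomputable section

/-! ### C⋆-algebras given by generators -/

/-- The C⋆-subalgebra of the C⋆-algebra `A` generated by a subset `S`. -/
def generatedCStar {A : Type u} [NonUnitalCStarAlgebra A] (S : Set A) :
    NonUnitalStarSubalgebra ℂ A :=
  (NonUnitalStarAlgebra.adjoin ℂ S).topologicalClosure

instance generatedCStar.isClosed {A : Type u} [NonUnitalCStarAlgebra A] (S : Set A) :
    IsClosed (generatedCStar S : Set A) :=
  NonUnitalStarSubalgebra.isClosed_topologicalClosure _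

theorem subset_generatedCStar {A : Type u} [NonUnitalCStarAlgebra A] (S : Set A) :
    S ⊆ generatedCStar S :=
  (NonUnitalStarAlgebra.subset_adjoin ℂ S).trans
    (NonUnitalStarSubalgebra.le_topologicalClosure _)

/-- A C⋆-algebra is simple if it is nonzero and its only closed two-sided ideals are
`0` and the whole algebra. -/
def IsSimpleCStarAlgebra (A : Type u) [NonUnitalCStarAlgebra A] : Prop :=
  Nontrivial A ∧ ∀ I : TwoSidedIdeal A, IsClosed {x : A | x ∈ I} → I = ⊥ ∨ I = ⊤

/-! ### Two-cocycles with values in the circle -/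

/-- The set `Z²(G, 𝕋)` of (normalised) `2`-cocycles on `G` with values in the circle group. -/
structure TwoCocycle (G : Type w) [Group G] where
  toFun : G → G → Circle
  one_left : ∀ g, toFun 1 g = 1
  one_right : ∀ g, toFun g 1 = 1
  cocycle : ∀ g h k, toFun g h * toFun (g * h) k = toFun g (h * k) * toFun h k

namespace TwoCocycle

variable {G : Type w} [Group G] (σ : TwoCocycle G)

theorem inv_symm (g : G) : σ.toFun g g⁻¹ = σ.toFun g⁻¹ g := by
  have := σ.cocycle g g⁻¹ g
  simpa [σ.one_left, σ.one_right] using this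

theorem inv_mul_aux (g h : G) :
    σ.toFun g h * σ.toFun (g * h) (h⁻¹ * g⁻¹) * σ.toFun h⁻¹ g⁻¹ =
      σ.toFun g g⁻¹ * σ.toFun h h⁻¹ := by
  have h1 := σ.cocycle (g * h) h⁻¹ g⁻¹
  have h2 := σ.cocycle g h h⁻¹
  simp only [mul_inv_cancel_right, mul_inv_cancel, σ.one_right, one_mul] at h1 h2
  rw [mul_assoc, ← h1, ← mul_assoc, h2, mul_comm]

end TwoCocycle

/-! ### Fell bundles over discrete groups -/

/-- A Fell bundle over the discrete group `G`. The total space of the bundle is `Σ g, fiber g`.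
For `b` in the fibre over `g` and `c` in the fibre over `h`, the product `bc` lies in the fibre
over `g * h`; it is written `mul e b c`, where `e : g * h = k` is any expression `k` of the index
of this fibre, so that associativity can be stated without transport between fibres. Likewise
`adj e b` is the adjoint `b⋆`, in the fibre over `g⁻¹`. -/
structure FellBundle (G : Type w) [Group G] where
  fiber : G → Type v
  [norm : ∀ g, NormedAddCommGroup (fiber g)]
  [space : ∀ g, NormedSpace ℂ (fiber g)]
  [complete : ∀ g, CompleteSpace (fiber g)]
  mul : ∀ {g h k : G}, g * h = k → fiber g → fiber h → fiber k
  adj : ∀ {g h : G}, g⁻¹ = h → fiber g → fiber h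
  mul_assoc : ∀ {g h k gh hk l : G} (e₁ : g * h = gh) (e₂ : gh * k = l) (e₃ : h * k = hk)
    (e₄ : g * hk = l) (a : fiber g) (b : fiber h) (c : fiber k),
    mul e₂ (mul e₁ a b) c = mul e₄ a (mul e₃ b c)
  add_mul : ∀ {g h k : G} (e : g * h = k) (a b : fiber g) (c : fiber h),
    mul e (a + b) c = mul e a c + mul e b c
  mul_add : ∀ {g h k : G} (e : g * h = k) (a : fiber g) (b c : fiber h),
    mul e a (b + c) = mul e a b + mul e a c
  smul_mul : ∀ {g h k : G} (e : g * h = k) (z : ℂ) (a : fiber g) (b : fiber h),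
    mul e (z • a) b = z • mul e a b
  mul_smul : ∀ {g h k : G} (e : g * h = k) (z : ℂ) (a : fiber g) (b : fiber h),
    mul e a (z • b) = z • mul e a b
  norm_mul_le : ∀ {g h k : G} (e : g * h = k) (a : fiber g) (b : fiber h),
    ‖mul e a b‖ ≤ ‖a‖ * ‖b‖
  adj_adj : ∀ {g h : G} (e : g⁻¹ = h) (e' : h⁻¹ = g) (a : fiber g), adj e' (adj e a) = a
  adj_add : ∀ {g h : G} (e : g⁻¹ = h) (a b : fiber g), adj e (a + b) = adj e a + adj e b
  adj_smul : ∀ {g h : G} (e : g⁻¹ = h) (z : ℂ) (a : fiber g), adj e (z • a) = conj z • adj e a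
  adj_mul : ∀ {g h k g' h' k' : G} (e₁ : g * h = k) (e₂ : k⁻¹ = k') (e₃ : g⁻¹ = g')
    (e₄ : h⁻¹ = h') (e₅ : h' * g' = k') (a : fiber g) (b : fiber h),
    adj e₂ (mul e₁ a b) = mul e₅ (adj e₄ b) (adj e₃ a)
  norm_adj_mul_self : ∀ {g h : G} (e : g⁻¹ = h) (e' : h * g = 1) (a : fiber g),
    ‖mul e' (adj e a) a‖ = ‖a‖ ^ 2
  /-- `a⋆a` is positive in the C⋆-algebra `fiber 1`, that is, of the form `c⋆c` there. -/
  adj_mul_self_pos : ∀ {g h : G} (e : g⁻¹ = h) (e' : h * g = 1) (a : fiber g),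
    ∃ c : fiber 1, mul e' (adj e a) a = mul (mul_one 1) (adj inv_one c) c

namespace FellBundle

variable {G : Type w} [Group G]

instance (B : FellBundle.{v} G) (g : G) : NormedAddCommGroup (B.fiber g) := B.norm g
instance (B : FellBundle.{v} G) (g : G) : NormedSpace ℂ (B.fiber g) := B.space g
instance (B : FellBundle.{v} G) (g : G) : CompleteSpace (B.fiber g) := B.complete g

/-- The deformation `B(σ)` of a Fell bundle `B` by a cocycle `σ`: the fibres are unchanged,
the new product of `b ∈ B_g` and `c ∈ B_h` is `σ(g,h)bc`, and the new adjoint of `b` is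
the complex conjugate of `σ(g,g⁻¹)` times `b⋆`. -/
def deform (B : FellBundle.{v} G) (σ : TwoCocycle G) : FellBundle.{v} G where
  fiber := B.fiber
  mul := fun {g h _} e b c => (σ.toFun g h : ℂ) • B.mul e b c
  adj := fun {g _} e b => conj (σ.toFun g g⁻¹ : ℂ) • B.adj e b
  mul_assoc := by
    rintro g h k _ _ _ rfl rfl rfl e₄ a b c
    rw [B.smul_mul, B.mul_smul, B.mul_assoc rfl rfl rfl e₄, smul_smul, smul_smul]
    congr 1
    have := congrArg (fun z : Circle => (z : ℂ)) (σ.cocycle g h k)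
    simp only [Circle.coe_mul] at this
    rw [← this, mul_comm]
  add_mul := by intros; rw [B.add_mul, smul_add]
  mul_add := by intros; rw [B.mul_add, smul_add]
  smul_mul := by intros; rw [B.smul_mul, smul_comm]
  mul_smul := by intros; rw [B.mul_smul, smul_comm]
  norm_mul_le := by
    intro g h k e a b
    rw [norm_smul, Circle.norm_coe, one_mul]
    exact B.norm_mul_le e a b
  adj_adj := by
    rintro g _ rfl e' a
    rw [B.adj_smul, B.adj_adj, smul_smul, inv_inv, ← σ.inv_symm g, RingHomCompTriple.comp_apply,
      RingHom.id_apply, ← Complex.normSq_eq_conj_mul_self, Complex.normSq_eq_norm_sq,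
      Circle.norm_coe]
    simp
  adj_add := by intros; rw [B.adj_add, smul_add]
  adj_smul := by intros; rw [B.adj_smul, smul_comm]
  adj_mul := by
    rintro g h _ _ _ _ rfl rfl rfl rfl e₅ a b
    rw [B.adj_smul, B.mul_smul, B.smul_mul, B.adj_mul rfl rfl rfl rfl e₅]
    simp only [smul_smul]
    congr 1
    have := congrArg (fun z : Circle => (z : ℂ)) (σ.inv_mul_aux g h)
    simp only [Circle.coe_mul] at this
    have h1 : conj (σ.toFun h⁻¹ g⁻¹ : ℂ) * (σ.toFun h⁻¹ g⁻¹ : ℂ) = 1 := by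
      rw [← Complex.normSq_eq_conj_mul_self, Complex.normSq_eq_norm_sq, Circle.norm_coe]
      simp
    have h2 := congrArg conj this
    simp only [map_mul] at h2
    rw [mul_inv_rev]
    linear_combination (-1 : ℂ) * conj (σ.toFun (g * h) (h⁻¹ * g⁻¹) : ℂ) *
      conj (σ.toFun g h : ℂ) * h1 + (σ.toFun h⁻¹ g⁻¹ : ℂ) * h2
  norm_adj_mul_self := by
    rintro g _ rfl e' a
    rw [norm_smul, Circle.norm_coe, one_mul, B.smul_mul, norm_smul, RCLike.norm_conj,
      Circle.norm_coe, one_mul, B.norm_adj_mul_self]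
  adj_mul_self_pos := by
    rintro g _ rfl e' a
    obtain ⟨c, hc⟩ := B.adj_mul_self_pos rfl e' a
    refine ⟨c, ?_⟩
    rw [B.smul_mul, B.smul_mul, smul_smul, hc, ← σ.inv_symm g, mul_comm,
      ← Complex.normSq_eq_conj_mul_self, Complex.normSq_eq_norm_sq, Circle.norm_coe]
    simp [σ.one_left]

/-- A representation of a Fell bundle in a C⋆-algebra `A`. -/
structure Rep (B : FellBundle.{v} G) (A : Type u) [NonUnitalCStarAlgebra A] where
  toFun : ∀ g : G, B.fiber g →ₗ[ℂ] A
  map_mul : ∀ {g h k : G} (e : g * h = k) (b : B.fiber g) (c : B.fiber h),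
    toFun k (B.mul e b c) = toFun g b * toFun h c
  map_adj : ∀ {g h : G} (e : g⁻¹ = h) (b : B.fiber g), toFun h (B.adj e b) = star (toFun g b)
  /-- The representation of `fiber 1` is nondegenerate. -/
  nondegenerate : (Submodule.span ℂ
    {x : A | ∃ (b : B.fiber 1) (a : A), x = toFun 1 b * a}).topologicalClosure = ⊤

/-- A copy of the fibre over the identity, to carry its structure of a C⋆-algebra. -/
def UnitFiber (B : FellBundle.{v} G) : Type v := B.fiber 1

instance (B : FellBundle.{v} G) : NormedAddCommGroup B.UnitFiber :=
  inferInstanceAs (NormedAddCommGroup (B.fiber 1))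
instance (B : FellBundle.{v} G) : NormedSpace ℂ B.UnitFiber :=
  inferInstanceAs (NormedSpace ℂ (B.fiber 1))
instance (B : FellBundle.{v} G) : CompleteSpace B.UnitFiber :=
  inferInstanceAs (CompleteSpace (B.fiber 1))

instance (B : FellBundle.{v} G) : NonUnitalNormedRing B.UnitFiber :=
  { (inferInstance : NormedAddCommGroup B.UnitFiber) with
    mul := fun a b => B.mul (mul_one 1) a b
    left_distrib := fun a b c => B.mul_add (mul_one 1) a b c
    right_distrib := fun a b c => B.add_mul (mul_one 1) a b c
    zero_mul := fun a => by
      have := B.smul_mul (mul_one 1) 0 (0 : B.fiber 1) a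
      rwa [zero_smul, zero_smul] at this
    mul_zero := fun a => by
      have := B.mul_smul (mul_one 1) 0 a (0 : B.fiber 1)
      rwa [zero_smul, zero_smul] at this
    mul_assoc := fun a b c =>
      B.mul_assoc (mul_one 1) (mul_one 1) (mul_one 1) (mul_one 1) a b c
    norm_mul_le := fun a b => B.norm_mul_le (mul_one 1) a b }

instance (B : FellBundle.{v} G) : StarRing B.UnitFiber where
  star a := B.adj inv_one a
  star_involutive a := B.adj_adj inv_one inv_one a
  star_mul a b := B.adj_mul (mul_one 1) inv_one inv_one inv_one (mul_one 1) a b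
  star_add a b := B.adj_add inv_one a b

instance (B : FellBundle.{v} G) : NonUnitalCStarAlgebra B.UnitFiber where
  norm_mul_self_le a := by
    have := B.norm_adj_mul_self inv_one (mul_one 1) a
    rw [← sq]
    exact this.ge
  smul_assoc z a b := B.smul_mul (mul_one 1) z a b
  smul_comm z a b := (B.mul_smul (mul_one 1) z a b).symm
  star_smul z a := B.adj_smul inv_one z a

namespace Rep

variable {B : FellBundle.{v} G} {A : Type u} [NonUnitalCStarAlgebra A]

/-- The restriction of a representation to the fibre over the identity. -/
def unitHom (π : Rep B A) : B.UnitFiber →⋆ₙₐ[ℂ] A where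
  toFun := π.toFun 1
  map_smul' z a := (π.toFun 1).map_smul z a
  map_zero' := (π.toFun 1).map_zero
  map_add' a b := (π.toFun 1).map_add a b
  map_mul' a b := π.map_mul (mul_one 1) a b
  map_star' a := π.map_adj inv_one a

theorem norm_le (π : Rep B A) (g : G) (b : B.fiber g) : ‖π.toFun g b‖ ≤ ‖b‖ := by
  let x : B.UnitFiber := B.mul (inv_mul_cancel g) (B.adj rfl b) b
  have h1 : ‖π.unitHom x‖ ≤ ‖x‖ := NonUnitalStarAlgHom.norm_apply_le π.unitHom x
  have h2 : π.unitHom x = star (π.toFun g b) * π.toFun g b := by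
    change π.toFun 1 _ = _
    rw [π.map_mul, π.map_adj]
  have h3 : ‖x‖ = ‖b‖ ^ 2 := B.norm_adj_mul_self rfl (inv_mul_cancel g) b
  rw [h2, h3, CStarRing.norm_star_mul_self, ← sq] at h1
  exact (sq_le_sq₀ (norm_nonneg _) (norm_nonneg _)).1 h1

end Rep

/-- A C⋆-algebra together with a representation of `B` in it. Up to isomorphism, every
C⋆-algebra generated by a representation of `B` occurs in this universe. -/
structure RepInto (B : FellBundle.{v} G) where
  alg : Type (max v w)
  [inst : NonUnitalCStarAlgebra alg]
  rep : Rep B alg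

instance (B : FellBundle.{v} G) (ρ : RepInto B) : NonUnitalCStarAlgebra ρ.alg := ρ.inst

/-- The image of `b` under the direct sum of all representations of `B`, as an element of the
`ℓ^∞`-product of the C⋆-algebras in which they take their values. -/
def univ (B : FellBundle.{v} G) {g : G} (b : B.fiber g) : lp (fun ρ : RepInto B => ρ.alg) ∞ :=
  ⟨fun ρ => ρ.rep.toFun g b, memℓp_infty ⟨‖b‖, by
    rintro _ ⟨ρ, rfl⟩
    exact ρ.rep.norm_le g b⟩⟩

/-- The C⋆-algebra `C⋆(B)` of a Fell bundle: the C⋆-algebra generated by the image of `B` under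
the direct sum of all its representations. -/
def CStar (B : FellBundle.{v} G) : Type (max (v + 1) (w + 1)) :=
  generatedCStar {x : lp (fun ρ : RepInto B => ρ.alg) ∞ | ∃ (g : G) (b : B.fiber g), x = B.univ b}

instance (B : FellBundle.{v} G) : NonUnitalCStarAlgebra B.CStar :=
  inferInstanceAs (NonUnitalCStarAlgebra (generatedCStar
    {x : lp (fun ρ : RepInto B => ρ.alg) ∞ | ∃ (g : G) (b : B.fiber g), x = B.univ b}))

end FellBundle

/-! ### Higher-rank graphs -/

/-- A `k`-graph: a small category with a degree functor to `ℕ^k` that has the unique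
factorisation property. Objects are the vertices; a path `λ` with range `r(λ) = w` and source
`s(λ) = u` is a morphism `λ : u ⟶ w`, and the composite path `λμ` is `μ ≫ λ`. -/
structure KGraph (k : ℕ) where
  Obj : Type u
  [cat : SmallCategory Obj]
  deg : ∀ {u v : Obj}, (u ⟶ v) → (Fin k → ℕ)
  deg_id : ∀ v : Obj, deg (𝟙 v) = 0
  deg_comp : ∀ {u v w : Obj} (f : u ⟶ v) (g : v ⟶ w), deg (f ≫ g) = deg g + deg f
  factorization : ∀ {u w : Obj} (f : u ⟶ w) (m n : Fin k → ℕ), deg f = m + n →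
    ∃! x : Σ v : Obj, (u ⟶ v) × (v ⟶ w), x.2.1 ≫ x.2.2 = f ∧ deg x.2.2 = m ∧ deg x.2.1 = n

namespace KGraph

variable {k : ℕ}

instance (Λ : KGraph.{u} k) : SmallCategory Λ.Obj := Λ.cat

/-- The set `wΛⁿ` of paths of degree `n` with range `w`. -/
def PathsTo (Λ : KGraph.{u} k) (w : Λ.Obj) (n : Fin k → ℕ) : Type u :=
  {x : Σ u : Λ.Obj, (u ⟶ w) // Λ.deg x.2 = n}

/-- `Λ` is row-finite: each `wΛⁿ` is finite. -/
def RowFinite (Λ : KGraph.{u} k) : Prop := ∀ w n, Finite (Λ.PathsTo w n)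

/-- `Λ` has no sources: each `wΛⁿ` is nonempty. -/
def NoSources (Λ : KGraph.{u} k) : Prop := ∀ w n, Nonempty (Λ.PathsTo w n)

/-- `Λ.IsSegment f p q τ` says that `τ` is the segment `f(p, q)` of the path `f`: in the
notation of paths, `f = β τ α` with `d(β) = p` and `d(βτ) = q`. By the factorisation
property there is exactly one such `τ` when `p ≤ q ≤ d(f)`. -/
def IsSegment (Λ : KGraph.{u} k) {u v : Λ.Obj} (f : u ⟶ v) (p q : Fin k → ℕ)
    (τ : Arrow Λ.Obj) : Prop :=
  ∃ (α : u ⟶ τ.left) (β : τ.right ⟶ v),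
    α ≫ τ.hom ≫ β = f ∧ Λ.deg β = p ∧ Λ.deg (τ.hom ≫ β) = q

/-- The (finite-path formulation of) aperiodicity: for all vertices `v` and `m ≠ n` in `ℕ^k`
there is a path `λ` with range `v` and `d(λ) ≥ m ∨ n` such that
`λ(m, m + d(λ) - (m ∨ n)) ≠ λ(n, n + d(λ) - (m ∨ n))`. -/
def Aperiodic (Λ : KGraph.{u} k) : Prop :=
  ∀ (v : Λ.Obj) (m n : Fin k → ℕ), m ≠ n →
    ∃ (u : Λ.Obj) (f : u ⟶ v), m ⊔ n ≤ Λ.deg f ∧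
      ∃ σ τ : Arrow Λ.Obj, Λ.IsSegment f m (m + (Λ.deg f - m ⊔ n)) σ ∧
        Λ.IsSegment f n (n + (Λ.deg f - m ⊔ n)) τ ∧ σ ≠ τ

/-- `Λ` is cofinal: for all vertices `v`, `w` there is `n` such that for each `λ` in `wΛⁿ` there
is a path with range `v` and source `s(λ)`. -/
def Cofinal (Λ : KGraph.{u} k) : Prop :=
  ∀ v w : Λ.Obj, ∃ n : Fin k → ℕ, ∀ x : Λ.PathsTo w n, Nonempty (x.1.1 ⟶ v)

/-- A Cuntz–Krieger `Λ`-family in a C⋆-algebra, for a row-finite `k`-graph `Λ`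
(so that the sum in the last relation is finite). -/
structure CKFamily (Λ : KGraph.{u} k) (A : Type v) [NonUnitalCStarAlgebra A] where
  toFun : ∀ {u v : Λ.Obj}, (u ⟶ v) → A
  proj : ∀ v : Λ.Obj, IsStarProjection (toFun (𝟙 v))
  orth : ∀ v w : Λ.Obj, v ≠ w → toFun (𝟙 v) * toFun (𝟙 w) = 0
  comp : ∀ {u v w : Λ.Obj} (f : u ⟶ v) (g : v ⟶ w), toFun g * toFun f = toFun (f ≫ g)
  star_mul_self : ∀ {u v : Λ.Obj} (f : u ⟶ v), star (toFun f) * toFun f = toFun (𝟙 u)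
  sum : ∀ (w : Λ.Obj) (n : Fin k → ℕ),
    toFun (𝟙 w) = ∑ᶠ x : Λ.PathsTo w n, toFun x.1.2 * star (toFun x.1.2)

namespace CKFamily

variable {Λ : KGraph.{u} k} {A : Type v} [NonUnitalCStarAlgebra A]

theorem norm_le (T : CKFamily Λ A) {u v : Λ.Obj} (f : u ⟶ v) : ‖T.toFun f‖ ≤ 1 := by
  have h1 : ‖T.toFun (𝟙 u)‖ * ‖T.toFun (𝟙 u)‖ = ‖T.toFun (𝟙 u)‖ := by
    rw [← CStarRing.norm_star_mul_self, (T.proj u).isSelfAdjoint.star_eq,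
      (T.proj u).isIdempotentElem.eq]
  have h2 : ‖T.toFun f‖ * ‖T.toFun f‖ = ‖T.toFun (𝟙 u)‖ := by
    rw [← CStarRing.norm_star_mul_self, T.star_mul_self]
  have h3 : ‖T.toFun (𝟙 u)‖ ≤ 1 := by
    by_contra! h
    nlinarith
  by_contra! h
  nlinarith

end CKFamily

/-- A C⋆-algebra together with a Cuntz–Krieger `Λ`-family in it. Up to isomorphism, every
C⋆-algebra generated by a Cuntz–Krieger `Λ`-family occurs in this universe. -/
structure CKInto (Λ : KGraph.{u} k) where
  alg : Type u
  [inst : NonUnitalCStarAlgebra alg]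
  fam : CKFamily Λ alg

instance (Λ : KGraph.{u} k) (ρ : CKInto Λ) : NonUnitalCStarAlgebra ρ.alg := ρ.inst

/-- The direct sum of all Cuntz–Krieger `Λ`-families, in the `ℓ^∞`-product of the C⋆-algebras
in which they take their values. -/
def univ (Λ : KGraph.{u} k) {u v : Λ.Obj} (f : u ⟶ v) : lp (fun ρ : CKInto Λ => ρ.alg) ∞ :=
  ⟨fun ρ => ρ.fam.toFun f, memℓp_infty ⟨1, by
    rintro _ ⟨ρ, rfl⟩
    exact ρ.fam.norm_le f⟩⟩

/-- The graph algebra `C⋆(Λ)`: the C⋆-algebra generated by the direct sum of all Cuntz–Krieger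
`Λ`-families. -/
def CStar (Λ : KGraph.{u} k) : Type (u + 1) :=
  generatedCStar {x : lp (fun ρ : CKInto Λ => ρ.alg) ∞ | ∃ (u v : Λ.Obj) (f : u ⟶ v), x = Λ.univ f}

instance (Λ : KGraph.{u} k) : NonUnitalCStarAlgebra Λ.CStar :=
  inferInstanceAs (NonUnitalCStarAlgebra (generatedCStar
    {x : lp (fun ρ : CKInto Λ => ρ.alg) ∞ | ∃ (u v : Λ.Obj) (f : u ⟶ v), x = Λ.univ f}))

/-- The canonical generator `s_λ` of `C⋆(Λ)`. -/
def gen (Λ : KGraph.{u} k) {u v : Λ.Obj} (f : u ⟶ v) : Λ.CStar :=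
  ⟨Λ.univ f, subset_generatedCStar _ ⟨u, v, f, rfl⟩⟩

/-- The generators `s_λ` of `C⋆(Λ)` form a Cuntz–Krieger `Λ`-family. -/
def canonicalFamily (Λ : KGraph.{u} k) (hΛ : Λ.RowFinite) : CKFamily Λ Λ.CStar where
  toFun := Λ.gen
  proj v := by
    constructor
    · exact Subtype.ext (Subtype.ext (funext fun ρ => (ρ.fam.proj v).isIdempotentElem.eq))
    · exact Subtype.ext (Subtype.ext (funext fun ρ => (ρ.fam.proj v).isSelfAdjoint.star_eq))
  orth v w h := Subtype.ext (Subtype.ext (funext fun ρ => ρ.fam.orth v w h))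
  comp f g := Subtype.ext (Subtype.ext (funext fun ρ => ρ.fam.comp f g))
  star_mul_self f := Subtype.ext (Subtype.ext (funext fun ρ => ρ.fam.star_mul_self f))
  sum w n := by
    have := hΛ w n
    have := Fintype.ofFinite (Λ.PathsTo w n)
    rw [finsum_eq_sum_of_fintype]
    refine Subtype.ext (Subtype.ext (funext fun ρ => ?_))
    refine (ρ.fam.sum w n).trans ?_
    rw [finsum_eq_sum_of_fintype]
    let ev : Λ.CStar →+ ρ.alg :=
      { toFun := fun x => x.1.1 ρ
        map_zero' := rfl
        map_add' := fun _ _ => rfl }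
    exact (map_sum ev (fun x : Λ.PathsTo w n => Λ.gen x.1.2 * star (Λ.gen x.1.2))
      Finset.univ).symm

/-- The value in `G` of a functor `η : Λ → G` at a path. -/
def label {Λ : KGraph.{u} k} {G : Type w} [Group G] (η : Λ.Obj ⥤ SingleObj G) {u v : Λ.Obj}
    (f : u ⟶ v) : G :=
  η.map f

theorem label_comp {Λ : KGraph.{u} k} {G : Type w} [Group G] (η : Λ.Obj ⥤ SingleObj G)
    {u v w : Λ.Obj} (f : u ⟶ v) (g : v ⟶ w) : label η (f ≫ g) = label η g * label η f :=
  η.map_comp f g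

namespace CKFamily

variable {Λ : KGraph.{u} k} {A : Type v} [NonUnitalCStarAlgebra A] (T : CKFamily Λ A)

theorem mul_id {u v : Λ.Obj} (f : u ⟶ v) : T.toFun f * T.toFun (𝟙 u) = T.toFun f := by
  rw [T.comp, Category.id_comp]

theorem id_mul {u v : Λ.Obj} (f : u ⟶ v) : T.toFun (𝟙 v) * T.toFun f = T.toFun f := by
  rw [T.comp, Category.comp_id]

theorem mul_eq_zero {u v u' v' : Λ.Obj} (f : u ⟶ v) (g : u' ⟶ v') (h : u ≠ v') :
    T.toFun f * T.toFun g = 0 := by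
  rw [← T.mul_id f, ← T.id_mul g, mul_assoc, ← mul_assoc (T.toFun (𝟙 u)), T.orth _ _ h, zero_mul,
    mul_zero]

theorem star_mul_eq_zero {u v u' v' : Λ.Obj} (f : u ⟶ v) (g : u' ⟶ v') (h : v ≠ v') :
    star (T.toFun f) * T.toFun g = 0 := by
  rw [← T.id_mul f, ← T.id_mul g, star_mul, (T.proj v).isSelfAdjoint.star_eq, mul_assoc,
    ← mul_assoc (T.toFun (𝟙 v)), T.orth _ _ h, zero_mul, mul_zero]

theorem star_mul_of_ne (hΛ : Λ.RowFinite) {w : Λ.Obj} {n : Fin k → ℕ} (x y : Λ.PathsTo w n)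
    (h : x ≠ y) : star (T.toFun x.1.2) * T.toFun y.1.2 = 0 := by
  classical
  let _ := CStarAlgebra.spectralOrder A
  let _ := CStarAlgebra.spectralOrderedRing A
  have := hΛ w n
  have := Fintype.ofFinite (Λ.PathsTo w n)
  have hs := T.sum w n
  rw [finsum_eq_sum_of_fintype] at hs
  let t : Λ.PathsTo w n → A := fun z => T.toFun z.1.2
  have h1 : ∑ z, (star (star (t z) * t y) * (star (t z) * t y)) = star (t y) * t y := by
    calc _ = star (t y) * (∑ z, t z * star (t z)) * t y := by
          rw [Finset.mul_sum, Finset.sum_mul]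
          exact Finset.sum_congr rfl fun z _ => by simp only [star_mul, star_star, mul_assoc]
      _ = _ := by
          rw [← hs, mul_assoc, T.id_mul]
  have h2 : star (star (t y) * t y) * (star (t y) * t y) = star (t y) * t y := by
    change star (star (T.toFun y.1.2) * T.toFun y.1.2) * (star (T.toFun y.1.2) * T.toFun y.1.2) = _
    rw [T.star_mul_self, (T.proj _).isSelfAdjoint.star_eq, (T.proj _).isIdempotentElem.eq]
  rw [← Finset.add_sum_erase _ _ (Finset.mem_univ y), h2, add_eq_left,
    Finset.sum_eq_zero_iff_of_nonneg fun z _ => star_mul_self_nonneg _] at h1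
  exact CStarRing.star_mul_self_eq_zero_iff _ |>.1
    (h1 x (Finset.mem_erase.2 ⟨h, Finset.mem_univ x⟩))

variable {G : Type w} [Group G] (η : Λ.Obj ⥤ SingleObj G)

/-- The elements `T_λ T_μ⋆` with `η(λ)η(μ)⁻¹ = g`. -/
def monomials (g : G) : Set A :=
  {x | ∃ (a b c d : Λ.Obj) (f : a ⟶ b) (f' : c ⟶ d),
    label η f * (label η f')⁻¹ = g ∧ x = T.toFun f * star (T.toFun f')}

theorem star_mul_mem (hΛ : Λ.RowFinite) {u v u' v' : Λ.Obj} (f : u ⟶ v) (f' : u' ⟶ v') :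
    star (T.toFun f) * T.toFun f' ∈
      Submodule.span ℂ (T.monomials η ((label η f)⁻¹ * label η f')) := by
  by_cases hv : v = v'
  · subst hv
    have h1 := T.sum u (Λ.deg f ⊔ Λ.deg f' - Λ.deg f)
    have h2 := T.sum u' (Λ.deg f ⊔ Λ.deg f' - Λ.deg f')
    have := hΛ u (Λ.deg f ⊔ Λ.deg f' - Λ.deg f)
    have := hΛ u' (Λ.deg f ⊔ Λ.deg f' - Λ.deg f')
    have := Fintype.ofFinite (Λ.PathsTo u (Λ.deg f ⊔ Λ.deg f' - Λ.deg f))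
    have := Fintype.ofFinite (Λ.PathsTo u' (Λ.deg f ⊔ Λ.deg f' - Λ.deg f'))
    rw [finsum_eq_sum_of_fintype] at h1 h2
    rw [← T.mul_id f, ← T.mul_id f', star_mul, (T.proj u).isSelfAdjoint.star_eq, h1, h2,
      Finset.sum_mul, Finset.sum_mul]
    refine Submodule.sum_mem _ fun x _ => ?_
    rw [Finset.mul_sum, Finset.mul_sum]
    refine Submodule.sum_mem _ fun y _ => ?_
    have key : T.toFun x.1.2 * star (T.toFun x.1.2) * star (T.toFun f) *
        (T.toFun f' * (T.toFun y.1.2 * star (T.toFun y.1.2))) =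
        T.toFun x.1.2 * (star (T.toFun (x.1.2 ≫ f)) * T.toFun (y.1.2 ≫ f')) *
          star (T.toFun y.1.2) := by
      rw [← T.comp, ← T.comp, star_mul]
      simp only [mul_assoc]
    rw [key]
    obtain ⟨⟨a, p⟩, hp⟩ := x
    obtain ⟨⟨b, q⟩, hq⟩ := y
    dsimp only at hp hq ⊢
    let X : Λ.PathsTo v (Λ.deg f ⊔ Λ.deg f') := ⟨⟨a, p ≫ f⟩, by
      rw [Λ.deg_comp, hp, add_tsub_cancel_of_le le_sup_left]⟩
    let Y : Λ.PathsTo v (Λ.deg f ⊔ Λ.deg f') := ⟨⟨b, q ≫ f'⟩, by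
      rw [Λ.deg_comp, hq, add_tsub_cancel_of_le le_sup_right]⟩
    by_cases hXY : X = Y
    · have h3 : (⟨a, p ≫ f⟩ : Σ u : Λ.Obj, (u ⟶ v)) = ⟨b, q ≫ f'⟩ := congrArg Subtype.val hXY
      obtain ⟨rfl, h4⟩ := Sigma.mk.inj_iff.1 h3
      have h5 := eq_of_heq h4
      rw [← h5, T.star_mul_self, T.mul_id]
      refine Submodule.subset_span ⟨_, _, _, _, p, q, ?_, rfl⟩
      have h6 := congrArg (label η) h5
      rw [label_comp, label_comp] at h6
      rw [eq_inv_mul_iff_mul_eq, ← mul_assoc, h6, mul_inv_cancel_right]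
    · have h3 : star (T.toFun (p ≫ f)) * T.toFun (q ≫ f') = 0 := T.star_mul_of_ne hΛ X Y hXY
      rw [h3, mul_zero, zero_mul]
      exact Submodule.zero_mem _
  · rw [T.star_mul_eq_zero _ _ hv]
    exact Submodule.zero_mem _

/-- The closed linear span of the elements `T_λ T_μ⋆` with `η(λ)η(μ)⁻¹ = g`. -/
def spectralSubspace (g : G) : Submodule ℂ A :=
  (Submodule.span ℂ (T.monomials η g)).topologicalClosure

theorem span_mul_mem (hΛ : Λ.RowFinite) {g h : G} {x y : A}
    (hx : x ∈ Submodule.span ℂ (T.monomials η g)) (hy : y ∈ Submodule.span ℂ (T.monomials η h)) :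
    x * y ∈ Submodule.span ℂ (T.monomials η (g * h)) := by
  induction hx, hy using Submodule.span_induction₂ with
  | mem_mem x y hx hy =>
    obtain ⟨a, b, c, d, f₁, f₂, rfl, rfl⟩ := hx
    obtain ⟨a', b', c', d', f₃, f₄, rfl, rfl⟩ := hy
    have key : ∀ z ∈ Submodule.span ℂ (T.monomials η ((label η f₂)⁻¹ * label η f₃)),
        T.toFun f₁ * z * star (T.toFun f₄) ∈ Submodule.span ℂ
          (T.monomials η (label η f₁ * (label η f₂)⁻¹ * (label η f₃ * (label η f₄)⁻¹))) := by
      intro z hz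
      induction hz using Submodule.span_induction with
      | mem z hz =>
        obtain ⟨p, q, p', q', e, e', he, rfl⟩ := hz
        by_cases h1 : a = q
        · subst h1
          by_cases h2 : c' = q'
          · subst h2
            refine Submodule.subset_span ⟨_, _, _, _, e ≫ f₁, e' ≫ f₄, ?_, ?_⟩
            · rw [label_comp, label_comp, mul_inv_rev]
              rw [show label η f₁ * label η e * ((label η e')⁻¹ * (label η f₄)⁻¹) =
                label η f₁ * (label η e * (label η e')⁻¹) * (label η f₄)⁻¹ by group, he]
              group
            · rw [← T.comp, ← T.comp, star_mul]
              simp only [mul_assoc]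
          · have : star (T.toFun e') * star (T.toFun f₄) = 0 := by
              rw [← star_mul, T.mul_eq_zero _ _ h2, star_zero]
            rw [mul_assoc (T.toFun f₁), mul_assoc (T.toFun e), this, mul_zero, mul_zero]
            exact Submodule.zero_mem _
        · rw [← mul_assoc (T.toFun f₁), T.mul_eq_zero _ _ h1, zero_mul, zero_mul]
          exact Submodule.zero_mem _
      | zero => simp
      | add x y _ _ hx hy =>
        rw [mul_add, add_mul]
        exact Submodule.add_mem _ hx hy
      | smul c x _ hx =>
        rw [mul_smul_comm, smul_mul_assoc]
        exact Submodule.smul_mem _ c hx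
    have := key _ (T.star_mul_mem η hΛ f₂ f₃)
    simpa only [mul_assoc] using this
  | zero_left y hy => simp
  | zero_right x hx => simp
  | add_left x y z _ _ _ hx hy =>
    rw [add_mul]
    exact Submodule.add_mem _ hx hy
  | add_right x y z _ _ _ hx hy =>
    rw [mul_add]
    exact Submodule.add_mem _ hx hy
  | smul_left r x y _ _ h =>
    rw [smul_mul_assoc]
    exact Submodule.smul_mem _ r h
  | smul_right r x y _ _ h =>
    rw [mul_smul_comm]
    exact Submodule.smul_mem _ r h

theorem mul_mem (hΛ : Λ.RowFinite) {g h l : G} (e : g * h = l) {x y : A}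
    (hx : x ∈ T.spectralSubspace η g) (hy : y ∈ T.spectralSubspace η h) :
    x * y ∈ T.spectralSubspace η l := by
  subst e
  exact map_mem_closure₂ continuous_mul hx hy fun a ha b hb => T.span_mul_mem η hΛ ha hb

theorem star_mem {g h : G} (e : g⁻¹ = h) {x : A} (hx : x ∈ T.spectralSubspace η g) :
    star x ∈ T.spectralSubspace η h := by
  subst e
  refine map_mem_closure continuous_star hx fun y hy => ?_
  change y ∈ Submodule.span ℂ (T.monomials η g) at hy
  change star y ∈ Submodule.span ℂ (T.monomials η g⁻¹)
  induction hy using Submodule.span_induction with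
  | mem z hz =>
    obtain ⟨a, b, c, d, f, f', rfl, rfl⟩ := hz
    exact Submodule.subset_span ⟨_, _, _, _, f', f, by simp, by simp⟩
  | zero => simp
  | add x y _ _ hx hy =>
    rw [star_add]
    exact Submodule.add_mem _ hx hy
  | smul c x _ hx =>
    rw [star_smul]
    exact Submodule.smul_mem _ _ hx

theorem isClosed_spectralSubspace (g : G) : IsClosed (T.spectralSubspace η g : Set A) :=
  Submodule.isClosed_topologicalClosure _

/-- The fibre over the identity, as a C⋆-subalgebra of `A`. -/
def unitSubalgebra (hΛ : Λ.RowFinite) : NonUnitalStarSubalgebra ℂ A where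
  toSubmodule := T.spectralSubspace η 1
  mul_mem' hx hy := T.mul_mem η hΛ (mul_one 1) hx hy
  star_mem' hx := T.star_mem η inv_one hx

theorem exists_sqrt (hΛ : Λ.RowFinite) {x : A} (hx : star x * x ∈ T.spectralSubspace η 1) :
    ∃ c ∈ T.spectralSubspace η 1, star x * x = star c * c := by
  let _ := CStarAlgebra.spectralOrder A
  let _ := CStarAlgebra.spectralOrderedRing A
  have hcl : IsClosed (T.unitSubalgebra η hΛ : Set A) := T.isClosed_spectralSubspace η 1
  have hpos : 0 ≤ star x * x := star_mul_self_nonneg x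
  refine ⟨CFC.sqrt (star x * x), ?_, ?_⟩
  · rw [CFC.sqrt_eq_real_sqrt _ hpos]
    exact cfcₙ_mem (s := T.unitSubalgebra η hΛ) Real.sqrt hx
  · rw [(IsSelfAdjoint.of_nonneg (CFC.sqrt_nonneg (star x * x))).star_eq,
      CFC.sqrt_mul_sqrt_self _ hpos]

end CKFamily

/-- The Fell bundle over `G` determined by a functor `η : Λ → G`: its fibres are
`B_g = closed span of {s_λ s_μ⋆ : η(λ)η(μ)⁻¹ = g}` in `C⋆(Λ)`, with the operations and the norm
of `C⋆(Λ)`. -/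
def fellBundle (Λ : KGraph.{u} k) (hΛ : Λ.RowFinite) {G : Type w} [Group G]
    (η : Λ.Obj ⥤ SingleObj G) : FellBundle.{u + 1} G where
  fiber g := (Λ.canonicalFamily hΛ).spectralSubspace η g
  complete g := ((Λ.canonicalFamily hΛ).isClosed_spectralSubspace η g).completeSpace_coe
  mul e a b := ⟨a.1 * b.1, (Λ.canonicalFamily hΛ).mul_mem η hΛ e a.2 b.2⟩
  adj e a := ⟨star a.1, (Λ.canonicalFamily hΛ).star_mem η e a.2⟩
  mul_assoc _ _ _ _ a b c := Subtype.ext (mul_assoc a.1 b.1 c.1)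
  add_mul _ a b c := Subtype.ext (add_mul a.1 b.1 c.1)
  mul_add _ a b c := Subtype.ext (mul_add a.1 b.1 c.1)
  smul_mul _ z a b := Subtype.ext (smul_mul_assoc z a.1 b.1)
  mul_smul _ z a b := Subtype.ext (mul_smul_comm z a.1 b.1)
  norm_mul_le _ a b := norm_mul_le a.1 b.1
  adj_adj _ _ a := Subtype.ext (star_star a.1)
  adj_add _ a b := Subtype.ext (star_add a.1 b.1)
  adj_smul _ z a := Subtype.ext (star_smul z a.1)
  adj_mul _ _ _ _ _ a b := Subtype.ext (star_mul a.1 b.1)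
  norm_adj_mul_self _ _ a := (CStarRing.norm_star_mul_self (x := a.1)).trans (sq _).symm
  adj_mul_self_pos e e' a := by
    obtain ⟨c, hc, h⟩ := (Λ.canonicalFamily hΛ).exists_sqrt η hΛ (x := a.1)
      ((Λ.canonicalFamily hΛ).mul_mem η hΛ e' ((Λ.canonicalFamily hΛ).star_mem η e a.2) a.2)
    exact ⟨⟨c, hc⟩, Subtype.ext h⟩

end KGraph

end

/-! Let t_f be the image of s_f in C⋆(B(σ)). Relations such as t_f⋆t_f = t_{s(f)} and the
Cuntz–Krieger sums survive the deformation unchanged; only products of paths pick up phases, and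
phases are harmless in the classical simplicity argument. That argument is therefore run for a
`TwistedFamily` in any C⋆-algebra A that is the closed span of the t_f t_g⋆ and carries a gauge
action of the torus.

Let I be a nonzero closed ideal and 0 ≠ x = a⋆a ∈ I. Averaging over the torus gives a contractive
map Φ with Φ(x) ≠ 0 which keeps the terms with d(f) = d(g) and kills the others
(`exists_expectation`). Let y be a finite linear combination of terms t_f t_g⋆ close to x. Then Φ(y)
lies in the image of a finite sum of matrix algebras, and contractions compress it to c t_v with |c|
large (`exists_compress_of_mem_bidegree`). Aperiodicity supplies a path l with range v such that
compression by t_l kills the off-diagonal terms of y (`exists_compress_eq_zero_of_finset`). Together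
the compressions take y to c t_u and x to an element of I near c t_u, so t_u ∈ I
(`TwoSidedIdeal.mem_of_norm_sub_lt`). Cofinality then puts every vertex projection into I, whence I
= A.

Amenability of G plays no role: the expectation comes from the torus, not from the grading by G. The
gauge action exists on the universal algebra because a representation of B(σ) composed with the
gauge action on the fibres is again a representation.

For the algebra to be nonzero, one nonzero representation suffices. The paths act by injections on
the infinite paths sharing a tail with a fixed one; this gives a Cuntz–Krieger family on ℓ²(X), and
its tensor product with the left regular σ-representation of G represents B(σ)
(`nontrivial_deformedCStar`). -/

noncomputable section

/-! ### Twisted Cuntz–Krieger families and compression by paths -/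

namespace KGraph

variable {k : ℕ}

theorem pathsTo_mk_inj {Λ : KGraph.{u} k} {a a' b : Λ.Obj} {n : Fin k → ℕ} {f : a ⟶ b}
    {f' : a' ⟶ b} {h : Λ.deg f = n} {h' : Λ.deg f' = n}
    (e : (⟨⟨a, f⟩, h⟩ : Λ.PathsTo b n) = ⟨⟨a', f'⟩, h'⟩) : a = a' ∧ f ≍ f' :=
  Sigma.mk.inj_iff.1 (congrArg Subtype.val e)

/-- A Cuntz–Krieger `Λ`-family in which products are only respected up to a scalar of modulus one:
a Cuntz–Krieger family twisted by some circle-valued cocycle. -/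
structure TwistedFamily (Λ : KGraph.{u} k) (A : Type v) [NonUnitalCStarAlgebra A] where
  toFun : ∀ {u v : Λ.Obj}, (u ⟶ v) → A
  star_id : ∀ v : Λ.Obj, star (toFun (𝟙 v)) = toFun (𝟙 v)
  mul_id : ∀ {u v : Λ.Obj} (f : u ⟶ v), toFun f * toFun (𝟙 u) = toFun f
  id_mul : ∀ {u v : Λ.Obj} (f : u ⟶ v), toFun (𝟙 v) * toFun f = toFun f
  comp : ∀ {u v w : Λ.Obj} (f : u ⟶ v) (g : v ⟶ w),
    ∃ z : ℂ, ‖z‖ = 1 ∧ toFun g * toFun f = z • toFun (f ≫ g)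
  star_mul_self : ∀ {u v : Λ.Obj} (f : u ⟶ v), star (toFun f) * toFun f = toFun (𝟙 u)
  star_mul_eq_zero : ∀ {u v u' v' : Λ.Obj} (f : u ⟶ v) (g : u' ⟶ v'), v ≠ v' →
    star (toFun f) * toFun g = 0
  star_mul_of_ne : ∀ {w : Λ.Obj} {n : Fin k → ℕ} (x y : Λ.PathsTo w n), x ≠ y →
    star (toFun x.1.2) * toFun y.1.2 = 0
  sum : ∀ (w : Λ.Obj) (n : Fin k → ℕ),
    toFun (𝟙 w) = ∑ᶠ x : Λ.PathsTo w n, toFun x.1.2 * star (toFun x.1.2)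

namespace TwistedFamily

variable {Λ : KGraph.{u} k} {A : Type v} [NonUnitalCStarAlgebra A] (T : TwistedFamily Λ A)

theorem id_mul_star {u v : Λ.Obj} (f : u ⟶ v) :
    T.toFun (𝟙 u) * star (T.toFun f) = star (T.toFun f) := by
  rw [← T.star_id, ← star_mul, T.mul_id]

theorem mul_star_eq_zero {u v u' v' : Λ.Obj} (f : u ⟶ v) (g : u' ⟶ v') (h : u ≠ u') :
    T.toFun f * star (T.toFun g) = 0 := by
  rw [← T.mul_id f, ← T.id_mul_star g, mul_assoc, ← mul_assoc (T.toFun (𝟙 u)), ← T.star_id u,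
    T.star_mul_eq_zero _ _ h, zero_mul, mul_zero]

theorem exists_comp {u v w : Λ.Obj} (f : u ⟶ v) (g : v ⟶ w) :
    ∃ z : ℂ, ‖z‖ = 1 ∧ T.toFun (f ≫ g) = z • (T.toFun g * T.toFun f) := by
  obtain ⟨z, hz, h⟩ := T.comp f g
  have hz0 : z ≠ 0 := by rintro rfl; simp at hz
  exact ⟨z⁻¹, by simp [hz], by rw [h, smul_smul, inv_mul_cancel₀ hz0, one_smul]⟩

/-- The span of the elements `t_f t_g⋆` with `d(f) = m` and `d(g) = n`. -/
def bidegree (m n : Fin k → ℕ) : Submodule ℂ A :=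
  Submodule.span ℂ {x | ∃ (a b c : Λ.Obj) (f : a ⟶ b) (g : a ⟶ c), Λ.deg f = m ∧ Λ.deg g = n ∧
    x = T.toFun f * star (T.toFun g)}

theorem bidegree_mem {a b c : Λ.Obj} (f : a ⟶ b) (g : a ⟶ c) :
    T.toFun f * star (T.toFun g) ∈ T.bidegree (Λ.deg f) (Λ.deg g) :=
  Submodule.subset_span ⟨a, b, c, f, g, rfl, rfl, rfl⟩

/-- Insert the Cuntz–Krieger sum over paths of degree p at the common source of f and g. This brings
terms of different degrees to a common one. -/
theorem bidegree_le_add (hΛ : Λ.RowFinite) (m n p : Fin k → ℕ) :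
    T.bidegree m n ≤ T.bidegree (m + p) (n + p) := by
  refine Submodule.span_le.2 ?_
  rintro _ ⟨a, b, c, f, g, rfl, rfl, rfl⟩
  have := hΛ a p
  have := Fintype.ofFinite (Λ.PathsTo a p)
  have hs := T.sum a p
  rw [finsum_eq_sum_of_fintype] at hs
  rw [← T.mul_id f, hs, Finset.mul_sum, Finset.sum_mul]
  refine Submodule.sum_mem _ fun x _ => ?_
  obtain ⟨⟨s, x⟩, rfl⟩ := x
  dsimp only
  obtain ⟨z, -, hz⟩ := T.comp x f
  obtain ⟨z', -, hz'⟩ := T.comp x g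
  rw [show T.toFun f * (T.toFun x * star (T.toFun x)) * star (T.toFun g) =
    T.toFun f * T.toFun x * star (T.toFun g * T.toFun x) by simp only [star_mul, mul_assoc],
    hz, hz', star_smul, smul_mul_smul_comm]
  refine Submodule.smul_mem _ _ ?_
  have := T.bidegree_mem (x ≫ f) (x ≫ g)
  rwa [Λ.deg_comp, Λ.deg_comp] at this

/-- Split off from f the initial part of degree d(g). It is either g itself, and cancels, or
orthogonal to g. -/
theorem star_mul_of_deg_eq_add {u v u' v' : Λ.Obj} (f : u ⟶ v) (g : u' ⟶ v') (p : Fin k → ℕ)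
    (h : Λ.deg f = Λ.deg g + p) :
    star (T.toFun g) * T.toFun f = 0 ∨ ∃ (f' : u ⟶ u') (z : ℂ), Λ.deg f' = p ∧ ‖z‖ = 1 ∧
      star (T.toFun g) * T.toFun f = z • T.toFun f' := by
  by_cases hv : v' = v
  · subst hv
    obtain ⟨⟨a, f₂, f₁⟩, ⟨rfl, h1, h2⟩, -⟩ := Λ.factorization f _ _ h
    dsimp only at f₁ f₂ h1 h2 h ⊢
    obtain ⟨z, hz, hz'⟩ := T.exists_comp f₂ f₁
    rw [hz', mul_smul_comm, ← mul_assoc]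
    by_cases hg : (⟨⟨u', g⟩, rfl⟩ : Λ.PathsTo v' (Λ.deg g)) = ⟨⟨a, f₁⟩, h1⟩
    · obtain ⟨rfl, hg⟩ := pathsTo_mk_inj hg
      cases eq_of_heq hg
      right
      exact ⟨f₂, z, h2, hz, by rw [T.star_mul_self, T.id_mul]⟩
    · left
      have : star (T.toFun g) * T.toFun f₁ = 0 := T.star_mul_of_ne _ _ hg
      rw [this, zero_mul, smul_zero]
  · exact Or.inl (T.star_mul_eq_zero _ _ hv)

/-- Lengthening both legs of each term by d(μ) = d(ν) makes them long enough for μ and ν to be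
stripped off again. Since bidegrees survive compression, off-diagonal terms can be killed one
bidegree at a time. -/
theorem star_mul_mul_mem_bidegree (hΛ : Λ.RowFinite) {a b a' b' : Λ.Obj} (μ : a ⟶ b)
    (ν : a' ⟶ b') (h : Λ.deg μ = Λ.deg ν) {m n : Fin k → ℕ} {x : A} (hx : x ∈ T.bidegree m n) :
    star (T.toFun μ) * x * T.toFun ν ∈ T.bidegree m n := by
  have hx' := T.bidegree_le_add hΛ m n (Λ.deg μ) hx
  clear hx
  induction hx' using Submodule.span_induction with
  | mem x hx =>
    obtain ⟨p, q, r, f, g, hf, hg, rfl⟩ := hx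
    rw [show star (T.toFun μ) * (T.toFun f * star (T.toFun g)) * T.toFun ν =
      star (T.toFun μ) * T.toFun f * star (star (T.toFun ν) * T.toFun g) by
        simp only [star_mul, star_star, mul_assoc]]
    rcases T.star_mul_of_deg_eq_add f μ m (by rw [hf, add_comm]) with h1 | ⟨f', z, hm, -, h1⟩
    · rw [h1, zero_mul]
      exact Submodule.zero_mem _
    rcases T.star_mul_of_deg_eq_add g ν n (by rw [hg, h, add_comm]) with h2 | ⟨g', z', hn, -, h2⟩
    · rw [h2, star_zero, mul_zero]
      exact Submodule.zero_mem _
    rw [h1, h2, star_smul, smul_mul_smul_comm]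
    refine Submodule.smul_mem _ _ ?_
    rw [← hm, ← hn]
    exact T.bidegree_mem f' g'
  | zero => simp
  | add x y _ _ hx hy =>
    rw [mul_add, add_mul]
    exact Submodule.add_mem _ hx hy
  | smul c x _ hx =>
    rw [mul_smul_comm, smul_mul_assoc]
    exact Submodule.smul_mem _ c hx

/-- If f is the initial part of l, removing it leaves a path that begins with the segment τ;
otherwise the product vanishes. -/
theorem star_mul_of_isSegment {u v a b : Λ.Obj} (l : u ⟶ v) (f : a ⟶ b) {q : Fin k → ℕ}
    {τ : Arrow Λ.Obj} (h : Λ.IsSegment l (Λ.deg f) q τ) :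
    star (T.toFun f) * T.toFun l = 0 ∨ ∃ x : A,
      star (T.toFun f) * T.toFun l = T.toFun τ.hom * x := by
  obtain ⟨c, d, t⟩ := τ
  obtain ⟨α, β, rfl, h1, -⟩ := h
  dsimp only [Functor.id_obj] at α β t h1 ⊢
  by_cases hb : b = v
  · subst hb
    obtain ⟨z, -, hz⟩ := T.exists_comp (α ≫ t) β
    obtain ⟨z', -, hz'⟩ := T.exists_comp α t
    rw [← Category.assoc, hz, hz', mul_smul_comm, ← mul_assoc]
    by_cases hf : (⟨⟨a, f⟩, rfl⟩ : Λ.PathsTo b (Λ.deg f)) = ⟨⟨d, β⟩, h1⟩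
    · obtain ⟨rfl, hg⟩ := pathsTo_mk_inj hf
      cases eq_of_heq hg
      right
      refine ⟨z • z' • T.toFun α, ?_⟩
      rw [T.star_mul_self]
      simp only [mul_smul_comm, ← mul_assoc]
      rw [T.id_mul]
    · left
      have : star (T.toFun f) * T.toFun β = 0 := T.star_mul_of_ne _ _ hf
      rw [this, zero_mul, smul_zero]
  · exact Or.inl (T.star_mul_eq_zero _ _ hb)

theorem deg_of_isSegment {u v : Λ.Obj} {l : u ⟶ v} {p q : Fin k → ℕ} {τ : Arrow Λ.Obj}
    (h : Λ.IsSegment l p (p + q) τ) : Λ.deg τ.hom = q := by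
  obtain ⟨α, β, -, h1, h2⟩ := h
  rw [Λ.deg_comp, h1] at h2
  exact add_left_cancel h2

theorem star_mul_of_arrow_ne {σ τ : Arrow Λ.Obj} (hd : Λ.deg σ.hom = Λ.deg τ.hom) (h : σ ≠ τ) :
    star (T.toFun σ.hom) * T.toFun τ.hom = 0 := by
  obtain ⟨a, b, f⟩ := σ
  obtain ⟨a', b', g⟩ := τ
  dsimp only [Functor.id_obj] at f g hd
  change star (T.toFun f) * T.toFun g = 0
  by_cases hb : b = b'
  · cases hb
    refine T.star_mul_of_ne (⟨⟨a, f⟩, hd⟩ : Λ.PathsTo b (Λ.deg g)) ⟨⟨a', g⟩, rfl⟩ fun e => h ?_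
    obtain ⟨rfl, hg⟩ := pathsTo_mk_inj e
    cases eq_of_heq hg
    rfl
  · exact T.star_mul_eq_zero _ _ hb

/-- With l from aperiodicity, t_l⋆ t_f t_g⋆ t_l = (t_f⋆t_l)⋆(t_g⋆t_l). The two factors start with
the segments of l at m and at n, which have equal degree and differ, hence are orthogonal. The path
l depends only on (m, n), not on f and g. -/
theorem exists_compress_eq_zero (hap : Λ.Aperiodic) (v : Λ.Obj) {m n : Fin k → ℕ} (hmn : m ≠ n) :
    ∃ (u : Λ.Obj) (l : u ⟶ v), ∀ x ∈ T.bidegree m n, star (T.toFun l) * x * T.toFun l = 0 := by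
  obtain ⟨u, l, -, σ, τ, hσ, hτ, hne⟩ := hap v m n hmn
  refine ⟨u, l, fun x hx => ?_⟩
  induction hx using Submodule.span_induction with
  | mem x hx =>
    obtain ⟨p, q, r, f, g, rfl, rfl, rfl⟩ := hx
    have hd := (deg_of_isSegment hσ).trans (deg_of_isSegment hτ).symm
    rw [show star (T.toFun l) * (T.toFun f * star (T.toFun g)) * T.toFun l =
      star (star (T.toFun f) * T.toFun l) * (star (T.toFun g) * T.toFun l) by
        simp only [star_mul, star_star, mul_assoc]]
    rcases T.star_mul_of_isSegment l f hσ with h1 | ⟨x, h1⟩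
    · rw [h1, star_zero, zero_mul]
    rcases T.star_mul_of_isSegment l g hτ with h2 | ⟨y, h2⟩
    · rw [h2, mul_zero]
    rw [h1, h2, star_mul, mul_assoc, ← mul_assoc (star (T.toFun σ.hom)),
      T.star_mul_of_arrow_ne hd hne, zero_mul, mul_zero]
  | zero => simp
  | add x y _ _ hx hy => rw [mul_add, add_mul, hx, hy, add_zero]
  | smul c x _ hx => rw [mul_smul_comm, smul_mul_assoc, hx, smul_zero]

theorem exists_compress_eq_zero_of_finset (hΛ : Λ.RowFinite) (hap : Λ.Aperiodic) (v : Λ.Obj)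
    (S : Finset ((Fin k → ℕ) × (Fin k → ℕ))) (hS : ∀ p ∈ S, p.1 ≠ p.2) :
    ∃ (u : Λ.Obj) (l : u ⟶ v), ∀ p ∈ S, ∀ x ∈ T.bidegree p.1 p.2,
      star (T.toFun l) * x * T.toFun l = 0 := by
  classical
  induction S using Finset.induction_on with
  | empty => exact ⟨v, 𝟙 v, by simp⟩
  | insert p S _ ih =>
    obtain ⟨u, l, hl⟩ := ih fun q hq => hS q (Finset.mem_insert_of_mem hq)
    obtain ⟨u', l', hl'⟩ := T.exists_compress_eq_zero hap u (hS p (Finset.mem_insert_self p S))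
    refine ⟨u', l' ≫ l, fun q hq x hx => ?_⟩
    obtain ⟨z, -, hz⟩ := T.exists_comp l' l
    -- Compression by l keeps the bidegree of the new pair, so l' still kills it; the old pairs are
    -- already zero after l.
    have key : star (T.toFun l') * (star (T.toFun l) * x * T.toFun l) * T.toFun l' = 0 := by
      rcases Finset.mem_insert.1 hq with rfl | hq
      · exact hl' _ (T.star_mul_mul_mem_bidegree hΛ l l rfl hx)
      · rw [hl q hq x hx, mul_zero, zero_mul]
    rw [hz, star_smul, smul_mul_assoc, smul_mul_assoc, mul_smul_comm, star_mul]
    simp only [mul_assoc] at key ⊢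
    rw [key, smul_zero, smul_zero]

end TwistedFamily

end KGraph

/-! ### Matrix units and compression to a scalar multiple of a projection -/

section MatrixUnits

open scoped Matrix.Norms.L2Operator

variable {A : Type v} [NonUnitalCStarAlgebra A]

/-- A finite family of elements of a C⋆-algebra whose products `w⋆w'` are orthonormal, with
values in projections `p i`. Then the `w_{i,a} w_{i,b}⋆` form a system of matrix units. -/
structure OrthonormalSystem {ι : Type u} (κ : ι → Type u) (A : Type v)
    [NonUnitalCStarAlgebra A] where
  w : ∀ i, κ i → A
  p : ι → A
  norm_p_le : ∀ i, ‖p i‖ ≤ 1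
  mul_p : ∀ i a, w i a * p i = w i a
  self : ∀ i a, star (w i a) * w i a = p i
  ne : ∀ i a b, a ≠ b → star (w i a) * w i b = 0
  ne' : ∀ i j a b, i ≠ j → star (w i a) * w j b = 0

namespace OrthonormalSystem

variable {ι : Type u} {κ : ι → Type u} [∀ i, Fintype (κ i)] (S : OrthonormalSystem κ A)

/-- The linear combination of the `w_{i,a}` with coefficients `ξ`. -/
def comb {i : ι} (ξ : κ i → ℂ) : A := ∑ a, ξ a • S.w i a

theorem star_w_mul_comb {i : ι} (a : κ i) (η : κ i → ℂ) :
    star (S.w i a) * S.comb η = η a • S.p i := by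
  rw [comb, Finset.mul_sum, Finset.sum_eq_single a]
  · rw [mul_smul_comm, S.self]
  · intro b _ hb
    rw [mul_smul_comm, S.ne _ _ _ hb.symm, smul_zero]
  · simp

theorem star_w_mul_comb_of_ne {i j : ι} (h : j ≠ i) (a : κ j) (η : κ i → ℂ) :
    star (S.w j a) * S.comb η = 0 := by
  rw [comb, Finset.mul_sum]
  exact Finset.sum_eq_zero fun b _ => by rw [mul_smul_comm, S.ne' _ _ _ _ h, smul_zero]

theorem star_comb_mul_comb {i : ι} (ξ η : κ i → ℂ) :
    star (S.comb ξ) * S.comb η = (∑ a, conj (ξ a) * η a) • S.p i := by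
  conv_lhs => rw [comb]
  rw [star_sum, Finset.sum_mul, Finset.sum_smul]
  refine Finset.sum_congr rfl fun a _ => ?_
  rw [star_smul, smul_mul_assoc, S.star_w_mul_comb, smul_smul]
  rfl

theorem norm_comb_le {i : ι} (ξ : EuclideanSpace ℂ (κ i)) (h : ‖ξ‖ ≤ 1) : ‖S.comb ξ‖ ≤ 1 := by
  have h1 : ‖star (S.comb ξ) * S.comb ξ‖ ≤ 1 := by
    rw [S.star_comb_mul_comb, norm_smul]
    have : ∑ a, conj (ξ a) * ξ a = ((‖ξ‖ ^ 2 : ℝ) : ℂ) := by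
      rw [EuclideanSpace.norm_sq_eq]
      push_cast
      exact Finset.sum_congr rfl fun a _ => Complex.conj_mul' _
    rw [this, Complex.norm_real, norm_pow, norm_norm]
    exact mul_le_one₀ (pow_le_one₀ (norm_nonneg _) h) (norm_nonneg _) (S.norm_p_le i)
  rw [CStarRing.norm_star_mul_self] at h1
  nlinarith [norm_nonneg (S.comb ξ)]

variable [Fintype ι]

/-- The linear map that takes the matrix units to the elements `w_{i,a} w_{i,b}⋆`. -/
def lin (Y : ∀ i, Matrix (κ i) (κ i) ℂ) : A :=
  ∑ i, ∑ b, ∑ a, Y i a b • (S.w i a * star (S.w i b))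

theorem lin_mul_comb (Y : ∀ i, Matrix (κ i) (κ i) ℂ) {i : ι} (η : κ i → ℂ) :
    S.lin Y * S.comb η = S.comb ((Y i).mulVec η) := by
  rw [lin, Finset.sum_mul, Finset.sum_eq_single i]
  · simp only [Finset.sum_mul, smul_mul_assoc, mul_assoc, S.star_w_mul_comb, mul_smul_comm, S.mul_p]
    rw [Finset.sum_comm]
    refine Finset.sum_congr rfl fun a _ => ?_
    rw [Matrix.mulVec, dotProduct, Finset.sum_smul]
    exact Finset.sum_congr rfl fun b _ => by rw [smul_smul]
  · intro j _ hj
    simp only [Finset.sum_mul, smul_mul_assoc, mul_assoc, S.star_w_mul_comb_of_ne hj, mul_zero,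
      smul_zero, Finset.sum_const_zero]
  · simp

theorem lin_eq (Y : ∀ i, Matrix (κ i) (κ i) ℂ) :
    S.lin Y = ∑ i, ∑ b, S.comb (fun a => Y i a b) * star (S.w i b) := by
  simp only [lin, comb, Finset.sum_mul, smul_mul_assoc]

/-- By `lin_eq`, `lin Z` is a sum over the columns of Z, and `lin Y` acts on a column as the matrix
Y acts on a vector. -/
theorem lin_mul (Y Z : ∀ i, Matrix (κ i) (κ i) ℂ) : S.lin (Y * Z) = S.lin Y * S.lin Z := by
  rw [S.lin_eq Z, S.lin_eq (Y * Z), Finset.mul_sum]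
  refine Finset.sum_congr rfl fun i _ => ?_
  rw [Finset.mul_sum]
  refine Finset.sum_congr rfl fun b _ => ?_
  rw [← mul_assoc, S.lin_mul_comb]
  rfl

theorem lin_star (Y : ∀ i, Matrix (κ i) (κ i) ℂ) : S.lin (star Y) = star (S.lin Y) := by
  simp only [lin, star_sum]
  refine Finset.sum_congr rfl fun i _ => ?_
  rw [Finset.sum_comm]
  refine Finset.sum_congr rfl fun a _ => Finset.sum_congr rfl fun b _ => ?_
  rw [star_smul, star_mul, star_star]
  rfl

variable [∀ i, DecidableEq (κ i)]

theorem lin_single [DecidableEq ι] (i : ι) (a b : κ i) :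
    S.lin (Pi.single i (Matrix.single a b 1)) = S.w i a * star (S.w i b) := by
  rw [lin, Finset.sum_eq_single i, Finset.sum_eq_single b, Finset.sum_eq_single a]
  · simp
  · intro c _ hc
    simp [Matrix.single, hc.symm]
  · simp
  · intro c _ hc
    refine Finset.sum_eq_zero fun d _ => ?_
    simp [Matrix.single, hc.symm]
  · simp
  · intro j _ hj
    simp [Pi.single_eq_of_ne hj]
  · simp

/-- The homomorphism from a finite direct sum of matrix algebras given by the matrix units
`w_{i,a} w_{i,b}⋆`. -/
def hom : (∀ i, Matrix (κ i) (κ i) ℂ) →⋆ₙₐ[ℂ] A where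
  toFun := S.lin
  map_smul' c Y := by simp [lin, Finset.smul_sum, smul_smul]
  map_zero' := by simp [lin]
  map_add' Y Z := by simp [lin, add_smul, Finset.sum_add_distrib]
  map_mul' := S.lin_mul
  map_star' := S.lin_star

/-- The range of the homomorphism given by the matrix units. -/
def range : Submodule ℂ A where
  carrier := Set.range S.hom
  add_mem' := by
    rintro _ _ ⟨Y, rfl⟩ ⟨Z, rfl⟩
    exact ⟨Y + Z, map_add S.hom Y Z⟩
  zero_mem' := ⟨0, map_zero S.hom⟩
  smul_mem' := by
    rintro c _ ⟨Y, rfl⟩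
    exact ⟨c • Y, map_smul S.hom c Y⟩

theorem mem_range [DecidableEq ι] (i : ι) (a b : κ i) :
    S.w i a * star (S.w i b) ∈ S.range :=
  ⟨_, S.lin_single i a b⟩

/-- A ∗-homomorphism is contractive, so some block Y i has operator norm above r. Take η in the unit
ball with ‖Y i η‖ > r and ξ = Y i η / ‖Y i η‖; then ⟨ξ, Y i η⟩ = ‖Y i η‖ is the scalar c.
Injectivity of `hom` is not needed. -/
theorem exists_compress {Y : ∀ i, Matrix (κ i) (κ i) ℂ} {r : ℝ} (hr : 0 ≤ r)
    (h : r < ‖S.hom Y‖) : ∃ (i : ι) (ξ η : κ i → ℂ) (c : ℂ), ‖S.comb ξ‖ ≤ 1 ∧ ‖S.comb η‖ ≤ 1 ∧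
      r < ‖c‖ ∧ star (S.comb ξ) * S.hom Y * S.comb η = c • S.p i := by
  have h1 : r < ‖Y‖ := h.trans_le (NonUnitalStarAlgHom.norm_apply_le S.hom Y)
  obtain ⟨i, hi⟩ : ∃ i, r < ‖Y i‖ := by
    by_contra! h2
    exact h1.not_ge ((pi_norm_le_iff_of_nonneg hr).2 h2)
  rw [Matrix.cstar_norm_def] at hi
  obtain ⟨η, hη, h2⟩ := ContinuousLinearMap.exists_lt_apply_of_lt_opNorm _ hi
  set ζ := Matrix.toEuclideanCLM (n := κ i) (𝕜 := ℂ) (Y i) η with hζ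
  have hζ0 : ‖ζ‖ ≠ 0 := (hr.trans_lt h2).ne'
  have hn : ‖((‖ζ‖⁻¹ : ℝ) : ℂ) • ζ‖ ≤ 1 := by
    rw [norm_smul, Complex.norm_real, norm_inv, norm_norm, inv_mul_cancel₀ hζ0]
  refine ⟨i, (((‖ζ‖⁻¹ : ℝ) : ℂ) • ζ : EuclideanSpace ℂ (κ i)), η, ‖ζ‖, S.norm_comb_le _ hn,
    S.norm_comb_le _ hη.le, by simpa using h2, ?_⟩
  change star (S.comb _) * S.lin Y * S.comb _ = _
  rw [mul_assoc, S.lin_mul_comb, S.star_comb_mul_comb]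
  congr 1
  have h3 : (Y i).mulVec η = ζ := by rw [hζ, Matrix.ofLp_toEuclideanCLM]
  rw [h3]
  have h4 : ∑ a, conj ((((‖ζ‖⁻¹ : ℝ) : ℂ) • ζ : EuclideanSpace ℂ (κ i)) a) * ζ a =
      ((‖ζ‖⁻¹ * ‖ζ‖ ^ 2 : ℝ) : ℂ) := by
    rw [EuclideanSpace.norm_sq_eq]
    push_cast
    rw [Finset.mul_sum]
    refine Finset.sum_congr rfl fun a _ => ?_
    rw [PiLp.smul_apply, smul_eq_mul, map_mul, mul_assoc, Complex.conj_mul', ← Complex.ofReal_inv,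
      Complex.conj_ofReal]
  rw [h4, sq, inv_mul_cancel_left₀ hζ0]

end OrthonormalSystem

end MatrixUnits

/-! ### Compressing elements of equal bidegree -/

namespace KGraph.TwistedFamily

variable {k : ℕ} {Λ : KGraph.{u} k} {A : Type v} [NonUnitalCStarAlgebra A]
  (T : TwistedFamily Λ A)

/-- The span of the elements `t_f` where `f` has degree `N` and source `v`. -/
def fromVertex (v : Λ.Obj) (N : Fin k → ℕ) : Submodule ℂ A :=
  Submodule.span ℂ {x | ∃ (b : Λ.Obj) (f : v ⟶ b), Λ.deg f = N ∧ x = T.toFun f}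

theorem norm_id_le (v : Λ.Obj) : ‖T.toFun (𝟙 v)‖ ≤ 1 := by
  have h := CStarRing.norm_star_mul_self (x := T.toFun (𝟙 v))
  rw [T.star_id, T.mul_id] at h
  by_contra! h'
  nlinarith

/-- The matrix units `t_f t_g⋆`, where `f` and `g` are paths of degree `N` in a finite set. -/
def system (N : Fin k → ℕ) (P : Finset (Σ a b : Λ.Obj, (a ⟶ b))) :
    OrthonormalSystem (ι := {v : Λ.Obj // ∃ x ∈ P, x.1 = v})
      (fun v => {x : Σ a b : Λ.Obj, (a ⟶ b) // x ∈ P ∧ Λ.deg x.2.2 = N ∧ x.1 = v.1}) A where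
  w _ x := T.toFun x.1.2.2
  p v := T.toFun (𝟙 v.1)
  norm_p_le v := T.norm_id_le v.1
  mul_p := by
    rintro ⟨v, _⟩ ⟨⟨a, b, f⟩, hf, hd, hv⟩
    dsimp only at hv
    subst hv
    exact T.mul_id f
  self := by
    rintro ⟨v, _⟩ ⟨⟨a, b, f⟩, hf, hd, hv⟩
    dsimp only at hv
    subst hv
    exact T.star_mul_self f
  ne := by
    rintro ⟨v, _⟩ ⟨⟨a, b, f⟩, hf, hd, hv⟩ ⟨⟨a', b', g⟩, hg, hd', hv'⟩ h
    dsimp only at hv hv' hd hd' ⊢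
    subst hv hv'
    by_cases hb : b = b'
    · subst hb
      refine T.star_mul_of_ne (⟨⟨a', f⟩, hd⟩ : Λ.PathsTo b N) ⟨⟨a', g⟩, hd'⟩ fun e => h ?_
      obtain ⟨-, e⟩ := pathsTo_mk_inj e
      cases eq_of_heq e
      rfl
    · exact T.star_mul_eq_zero _ _ hb
  ne' := by
    rintro ⟨v, _⟩ ⟨v', _⟩ ⟨⟨a, b, f⟩, hf, hd, hv⟩ ⟨⟨a', b', g⟩, hg, hd', hv'⟩ h
    dsimp only at hv hv' hd hd' ⊢
    subst hv hv'
    by_cases hb : b = b'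
    · subst hb
      refine T.star_mul_of_ne (⟨⟨a, f⟩, hd⟩ : Λ.PathsTo b N) ⟨⟨a', g⟩, hd'⟩ fun e => h ?_
      obtain ⟨e, -⟩ := pathsTo_mk_inj e
      cases e
      rfl
    · exact T.star_mul_eq_zero _ _ hb

/-- There may be infinitely many vertices, and infinitely many paths of degree N out of one vertex.
A single linear combination involves only finitely many of them, which makes finite matrix algebras
available. -/
theorem exists_finset_of_mem_bidegree {N : Fin k → ℕ} {y : A} (hy : y ∈ T.bidegree N N) :
    ∃ P : Finset (Σ a b : Λ.Obj, (a ⟶ b)),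
      y ∈ Submodule.span ℂ {x | ∃ (a b c : Λ.Obj) (f : a ⟶ b) (g : a ⟶ c), Λ.deg f = N ∧
        Λ.deg g = N ∧ ⟨a, b, f⟩ ∈ P ∧ ⟨a, c, g⟩ ∈ P ∧ x = T.toFun f * star (T.toFun g)} := by
  classical
  induction hy using Submodule.span_induction with
  | mem x hx =>
    obtain ⟨a, b, c, f, g, hf, hg, rfl⟩ := hx
    exact ⟨{⟨a, b, f⟩, ⟨a, c, g⟩}, Submodule.subset_span
      ⟨a, b, c, f, g, hf, hg, by simp, by simp, rfl⟩⟩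
  | zero => exact ⟨∅, Submodule.zero_mem _⟩
  | add x y _ _ hx hy =>
    obtain ⟨P, hP⟩ := hx
    obtain ⟨Q, hQ⟩ := hy
    refine ⟨P ∪ Q, Submodule.add_mem _ (Submodule.span_mono ?_ hP) (Submodule.span_mono ?_ hQ)⟩
    · rintro _ ⟨a, b, c, f, g, hf, hg, h1, h2, rfl⟩
      exact ⟨a, b, c, f, g, hf, hg, Finset.mem_union_left _ h1, Finset.mem_union_left _ h2, rfl⟩
    · rintro _ ⟨a, b, c, f, g, hf, hg, h1, h2, rfl⟩
      exact ⟨a, b, c, f, g, hf, hg, Finset.mem_union_right _ h1, Finset.mem_union_right _ h2, rfl⟩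
  | smul c x _ hx =>
    obtain ⟨P, hP⟩ := hx
    exact ⟨P, Submodule.smul_mem _ c hP⟩

/-- That X and Z combine paths of the same degree N is recorded because it makes b ↦ X⋆bZ preserve
the bidegrees of the off-diagonal terms too. -/
theorem exists_compress_of_mem_bidegree {N : Fin k → ℕ} {y : A} (hy : y ∈ T.bidegree N N) {r : ℝ}
    (hr : 0 ≤ r) (h : r < ‖y‖) : ∃ (v : Λ.Obj) (X Z : A) (c : ℂ), X ∈ T.fromVertex v N ∧
      Z ∈ T.fromVertex v N ∧ ‖X‖ ≤ 1 ∧ ‖Z‖ ≤ 1 ∧ r < ‖c‖ ∧ star X * y * Z = c • T.toFun (𝟙 v) := by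
  classical
  obtain ⟨P, hP⟩ := T.exists_finset_of_mem_bidegree hy
  have : Finite {v : Λ.Obj // ∃ x ∈ P, x.1 = v} := by
    refine Set.Finite.to_subtype ((P.finite_toSet.image Sigma.fst).subset ?_)
    rintro v ⟨x, hx, rfl⟩
    exact ⟨x, hx, rfl⟩
  have := Fintype.ofFinite {v : Λ.Obj // ∃ x ∈ P, x.1 = v}
  have (v : {v : Λ.Obj // ∃ x ∈ P, x.1 = v}) :
      Finite {x : Σ a b : Λ.Obj, (a ⟶ b) // x ∈ P ∧ Λ.deg x.2.2 = N ∧ x.1 = v.1} :=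
    Set.Finite.to_subtype (P.finite_toSet.subset fun x hx => hx.1)
  have (v : {v : Λ.Obj // ∃ x ∈ P, x.1 = v}) := Fintype.ofFinite
    {x : Σ a b : Λ.Obj, (a ⟶ b) // x ∈ P ∧ Λ.deg x.2.2 = N ∧ x.1 = v.1}
  let S := T.system N P
  obtain ⟨Y, rfl⟩ : y ∈ S.range := by
    refine Submodule.span_le.2 ?_ hP
    rintro _ ⟨a, b, c, f, g, hf, hg, h1, h2, rfl⟩
    let i : {v : Λ.Obj // ∃ x ∈ P, x.1 = v} := ⟨a, _, h1, rfl⟩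
    exact S.mem_range i ⟨⟨a, b, f⟩, h1, hf, rfl⟩ ⟨⟨a, c, g⟩, h2, hg, rfl⟩
  obtain ⟨v, ξ, η, c, h1, h2, h3, h4⟩ := S.exists_compress hr h
  have hmem : ∀ ζ, S.comb (i := v) ζ ∈ T.fromVertex v.1 N := by
    refine fun ζ => Submodule.sum_mem _ fun x _ => Submodule.smul_mem _ _ ?_
    obtain ⟨⟨a, b, f⟩, hf, hd, hv⟩ := x
    obtain ⟨v, _⟩ := v
    dsimp only at hv
    subst hv
    exact Submodule.subset_span ⟨b, f, hd, rfl⟩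
  exact ⟨v.1, S.comb ξ, S.comb η, c, hmem ξ, hmem η, h1, h2, h3, h4⟩

theorem star_mul_mul_mem_bidegree_of_fromVertex (hΛ : Λ.RowFinite) {v : Λ.Obj}
    {N m n : Fin k → ℕ} {X Z y : A} (hX : X ∈ T.fromVertex v N) (hZ : Z ∈ T.fromVertex v N)
    (hy : y ∈ T.bidegree m n) : star X * y * Z ∈ T.bidegree m n := by
  induction hX, hZ using Submodule.span_induction₂ with
  | mem_mem x z hx hz =>
    obtain ⟨b, f, hf, rfl⟩ := hx
    obtain ⟨c, g, hg, rfl⟩ := hz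
    exact T.star_mul_mul_mem_bidegree hΛ f g (hf.trans hg.symm) hy
  | zero_left z hz => simp
  | zero_right x hx => simp
  | add_left x x' z _ _ _ hx hx' =>
    rw [star_add, add_mul, add_mul]
    exact Submodule.add_mem _ hx hx'
  | add_right x z z' _ _ _ hz hz' =>
    rw [mul_add]
    exact Submodule.add_mem _ hz hz'
  | smul_left c x z _ _ h =>
    rw [star_smul, smul_mul_assoc, smul_mul_assoc]
    exact Submodule.smul_mem _ _ h
  | smul_right c x z _ _ h =>
    rw [mul_smul_comm]
    exact Submodule.smul_mem _ _ h

end KGraph.TwistedFamily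

/-! ### Averaging over a compact group -/

section Averaging

open MeasureTheory

variable {K : Type w} [TopologicalSpace K] [MeasurableSpace K] [BorelSpace K] {μ : Measure K}

/-- Translation by x₀ multiplies the integral by χ(x₀) ≠ 1 but leaves it unchanged. -/
theorem integral_character_eq_zero [Group K] [IsTopologicalGroup K] [μ.IsMulLeftInvariant] (χ : K →* Circle)
    {x₀ : K} (h : χ x₀ ≠ 1) : ∫ x, (χ x : ℂ) ∂μ = 0 := by
  have h1 := integral_mul_left_eq_self (μ := μ) (fun x => (χ x : ℂ)) x₀
  simp only [map_mul, Circle.coe_mul] at h1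
  rw [integral_const_mul, ← sub_eq_zero, ← sub_one_mul, mul_eq_zero, sub_eq_zero] at h1
  exact h1.resolve_left fun h2 => h (Circle.ext h2)

variable [CompactSpace K] [SecondCountableTopology K]

theorem Continuous.integrable_of_compactSpace {A : Type v} [NormedAddCommGroup A]
    [IsFiniteMeasure μ] {f : K → A} (hf : Continuous f) : Integrable f μ := by
  obtain ⟨C, hC⟩ := isCompact_univ.exists_bound_of_continuousOn hf.continuousOn
  exact Integrable.of_bound hf.aestronglyMeasurable C (ae_of_all _ fun x => hC x (Set.mem_univ x))

theorem integral_star_mul_self_ne_zero {A : Type v} [NonUnitalCStarAlgebra A] [IsFiniteMeasure μ]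
    [μ.IsOpenPosMeasure] {f : K → A} (hf : Continuous f) {x₀ : K} (h0 : f x₀ ≠ 0) :
    ∫ x, star (f x) * f x ∂μ ≠ 0 := by
  let _ := CStarAlgebra.spectralOrder A
  let _ := CStarAlgebra.spectralOrderedRing A
  intro h
  let F : K → A := fun x => star (f x) * f x
  have hF : Continuous F := by fun_prop
  have hpos : ∀ x, 0 ≤ F x := fun x => star_mul_self_nonneg _
  have hF0 : 0 < ‖F x₀‖ := by
    rw [norm_pos_iff]
    exact fun h1 => h0 ((CStarRing.star_mul_self_eq_zero_iff _).1 h1)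
  -- If the integral of F ≥ 0 vanishes, so does the integral over U. Since F stays within ‖F x₀‖/2
  -- of F x₀ on U, this would give ‖F x₀‖ μ(U) ≤ ‖F x₀‖ μ(U)/2 with μ(U) > 0.
  let U : Set K := {x | ‖F x - F x₀‖ < ‖F x₀‖ / 2}
  have hU : IsOpen U := isOpen_lt (by fun_prop) continuous_const
  have hint : Integrable F μ := hF.integrable_of_compactSpace
  have h1 : ∫ x in U, F x ∂μ = 0 := by
    have h2 := integral_add_compl hU.measurableSet hint
    rw [show ∫ x, F x ∂μ = 0 from h] at h2
    have h3 : 0 ≤ ∫ x in U, F x ∂μ := integral_nonneg hpos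
    have h4 : 0 ≤ ∫ x in Uᶜ, F x ∂μ := integral_nonneg hpos
    exact ((add_eq_zero_iff_of_nonneg h3 h4).1 h2).1
  have h2 : ‖∫ x in U, (F x - F x₀) ∂μ‖ ≤ ‖F x₀‖ / 2 * μ.real U :=
    norm_setIntegral_le_of_norm_le_const (measure_lt_top _ _) fun x hx => le_of_lt hx
  rw [integral_sub hint.integrableOn (integrable_const _), h1, zero_sub, norm_neg,
    setIntegral_const, norm_smul, Real.norm_of_nonneg measureReal_nonneg] at h2
  have h3 : 0 < μ.real U := by
    refine ENNReal.toReal_pos (hU.measure_pos μ ⟨x₀, ?_⟩).ne' (measure_lt_top _ _).ne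
    change ‖F x₀ - F x₀‖ < ‖F x₀‖ / 2
    simpa using hF0
  nlinarith

end Averaging

/-! ### Gauge characters and the faithful expectation -/

namespace KGraph

variable {k : ℕ}

/-- The character `z ↦ z^(m - n)` of the torus. -/
def gaugeChar (m n : Fin k → ℕ) : (Fin k → Circle) →* Circle where
  toFun z := ∏ i, z i ^ ((m i : ℤ) - n i)
  map_one' := by simp
  map_mul' z w := by simp [mul_zpow, Finset.prod_mul_distrib]

theorem gaugeChar_self (m : Fin k → ℕ) (z : Fin k → Circle) : gaugeChar m m z = 1 := by
  simp [gaugeChar]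

theorem continuous_gaugeChar (m n : Fin k → ℕ) : Continuous (gaugeChar m n) := by
  change Continuous fun z : Fin k → Circle => ∏ i, z i ^ ((m i : ℤ) - n i)
  fun_prop

theorem exists_gaugeChar_ne_one {m n : Fin k → ℕ} (h : m ≠ n) :
    ∃ z, gaugeChar m n z ≠ 1 := by
  obtain ⟨i, hi⟩ := Function.ne_iff.1 h
  have hd : ((m i : ℤ) - n i) ≠ 0 := by omega
  have hd' : (((m i : ℤ) - n i : ℤ) : ℝ) ≠ 0 := by exact_mod_cast hd
  -- The angle π/(m_i − n_i) in the i-th coordinate makes the character take the value −1.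
  refine ⟨Pi.mulSingle i (Circle.exp (Real.pi / ((m i : ℤ) - n i : ℤ))), ?_⟩
  have h1 : gaugeChar m n (Pi.mulSingle i (Circle.exp (Real.pi / ((m i : ℤ) - n i : ℤ)))) =
      Circle.exp (Real.pi / ((m i : ℤ) - n i : ℤ)) ^ ((m i : ℤ) - n i) := by
    change ∏ j : Fin k, _ = _
    rw [Finset.prod_eq_single i]
    · simp
    · intro j _ hj
      simp [hj]
    · simp
  rw [h1, ← Circle.exp_zsmul, zsmul_eq_mul, mul_div_cancel₀ _ hd']
  intro h2
  have h3 := congrArg (fun z : Circle => (z : ℂ)) h2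
  simp at h3
  norm_num at h3

namespace TwistedFamily

variable {Λ : KGraph.{u} k} {A : Type v} [NonUnitalCStarAlgebra A] (T : TwistedFamily Λ A)

/-- The linear span of the elements `t_f t_g⋆`. -/
def polynomials : Submodule ℂ A := ⨆ p : (Fin k → ℕ) × (Fin k → ℕ), T.bidegree p.1 p.2

theorem mem_polynomials {m n : Fin k → ℕ} {x : A} (hx : x ∈ T.bidegree m n) :
    x ∈ T.polynomials :=
  Submodule.mem_iSup_of_mem (m, n) hx

section Gauge

variable {γ : (Fin k → Circle) → A →⋆ₙₐ[ℂ] A}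

theorem gauge_apply_of_mem_bidegree
    (hγ : ∀ z {a b c : Λ.Obj} (f : a ⟶ b) (g : a ⟶ c), γ z (T.toFun f * star (T.toFun g)) =
      (gaugeChar (Λ.deg f) (Λ.deg g) z : ℂ) • (T.toFun f * star (T.toFun g)))
    (z : Fin k → Circle) {m n : Fin k → ℕ} {x : A} (hx : x ∈ T.bidegree m n) :
    γ z x = (gaugeChar m n z : ℂ) • x := by
  induction hx using Submodule.span_induction with
  | mem x hx =>
    obtain ⟨a, b, c, f, g, rfl, rfl, rfl⟩ := hx
    exact hγ z f g
  | zero => simp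
  | add x y _ _ hx hy => rw [map_add, hx, hy, smul_add]
  | smul c x _ hx => rw [map_smul, hx, smul_comm]

theorem exists_polynomial_near (hT : T.polynomials.topologicalClosure = ⊤)
    (x : A) {ε : ℝ} (hε : 0 < ε) : ∃ y ∈ T.polynomials, ‖x - y‖ < ε := by
  have hx : x ∈ T.polynomials.topologicalClosure := by rw [hT]; trivial
  obtain ⟨y, hy, h⟩ := Metric.mem_closure_iff.1 hx ε hε
  exact ⟨y, hy, by rwa [← dist_eq_norm]⟩

/-- On polynomials the orbit map is a finite sum of characters. Each γ z is contractive, so a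
general orbit map is a uniform limit of these. -/
theorem continuous_gauge (hT : T.polynomials.topologicalClosure = ⊤)
    (hγ : ∀ z (m n : Fin k → ℕ), ∀ x ∈ T.bidegree m n, γ z x = (gaugeChar m n z : ℂ) • x)
    (x : A) : Continuous fun z => γ z x := by
  refine continuous_of_uniform_approx_of_continuous fun U hU => ?_
  obtain ⟨ε, hε, hεU⟩ := Metric.mem_uniformity_dist.1 hU
  obtain ⟨y, hy, hxy⟩ := T.exists_polynomial_near hT x hε
  refine ⟨fun z => γ z y, ?_, fun z => hεU ?_⟩
  · refine Submodule.iSup_induction _ (motive := fun y => Continuous fun z => γ z y) hy ?_ ?_ ?_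
    · intro p y hy
      simp only [hγ _ _ _ y hy]
      exact (continuous_subtype_val.comp (continuous_gaugeChar _ _)).smul continuous_const
    · simpa using continuous_const
    · intro y y' h h'
      simp only [map_add]
      exact h.add h'
  · rw [dist_eq_norm, ← map_sub]
    exact (NonUnitalStarAlgHom.norm_apply_le (γ z) _).trans_lt hxy

/-- The maps γ z are not assumed to form a group action; density of the polynomials supplies the
only instance needed, at z = 1. -/
theorem gauge_one (hT : T.polynomials.topologicalClosure = ⊤)
    (hγ : ∀ z (m n : Fin k → ℕ), ∀ x ∈ T.bidegree m n, γ z x = (gaugeChar m n z : ℂ) • x)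
    (x : A) : γ 1 x = x := by
  rw [← sub_eq_zero, ← norm_le_zero_iff]
  refine le_of_forall_pos_le_add fun ε hε => ?_
  obtain ⟨y, hy, hxy⟩ := T.exists_polynomial_near hT x (half_pos hε)
  have h1 : γ 1 y = y := by
    refine Submodule.iSup_induction _ (motive := fun y => γ 1 y = y) hy ?_ ?_ ?_
    · intro p y hy
      rw [hγ _ _ _ y hy, map_one, Circle.coe_one, one_smul]
    · simp
    · intro y y' h h'
      rw [map_add, h, h']
  have h2 : γ 1 x - x = γ 1 (x - y) - (x - y) := by rw [map_sub, h1]; abel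
  rw [h2]
  have h3 := norm_sub_le (γ 1 (x - y)) (x - y)
  have h4 := NonUnitalStarAlgHom.norm_apply_le (γ 1) (x - y)
  linarith

open MeasureTheory in
/-- The restriction to the polynomials of the conditional expectation onto the fixed points of the
gauge action is bounded, and the expectation is faithful. -/
theorem exists_expectation (hT : T.polynomials.topologicalClosure = ⊤)
    (hγ : ∀ z (m n : Fin k → ℕ), ∀ x ∈ T.bidegree m n, γ z x = (gaugeChar m n z : ℂ) • x) :
    ∃ Φ : A → A, (∀ x y, ‖Φ x - Φ y‖ ≤ ‖x - y‖) ∧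
    (∀ x y, Φ (x + y) = Φ x + Φ y) ∧ (∀ n, ∀ x ∈ T.bidegree n n, Φ x = x) ∧
    (∀ m n, m ≠ n → ∀ x ∈ T.bidegree m n, Φ x = 0) ∧ ∀ a, a ≠ 0 → Φ (star a * a) ≠ 0 := by
  let _ : MeasurableSpace (Fin k → Circle) := borel _
  have : BorelSpace (Fin k → Circle) := ⟨rfl⟩
  -- Normalised by total mass one, so that the average fixes the terms of equal degrees.
  let μ : Measure (Fin k → Circle) := Measure.haarMeasure ⊤
  have : IsProbabilityMeasure μ := ⟨Measure.haarMeasure_self (K₀ := ⊤)⟩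
  have hint : ∀ x, Integrable (fun z => γ z x) μ := fun x =>
    (T.continuous_gauge hT hγ x).integrable_of_compactSpace
  have hchar : ∀ m n, ∀ x ∈ T.bidegree m n,
      ∫ z, γ z x ∂μ = (∫ z, (gaugeChar m n z : ℂ) ∂μ) • x := by
    intro m n x hx
    simp only [hγ _ _ _ x hx]
    exact integral_smul_const _ _
  refine ⟨fun x => ∫ z, γ z x ∂μ, fun x y => ?_, fun x y => ?_, fun n x hx => ?_,
    fun m n hmn x hx => ?_, fun a ha => ?_⟩
  · rw [← integral_sub (hint x) (hint y)]
    refine (norm_integral_le_of_norm_le_const (C := ‖x - y‖) (ae_of_all _ fun z => ?_)).trans ?_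
    · rw [← map_sub]
      exact NonUnitalStarAlgHom.norm_apply_le _ _
    · simp
  · simp only [map_add]
    exact integral_add (hint x) (hint y)
  · beta_reduce
    rw [hchar n n x hx]
    simp [gaugeChar_self]
  · obtain ⟨z, hz⟩ := exists_gaugeChar_ne_one hmn
    beta_reduce
    rw [hchar m n x hx, integral_character_eq_zero _ hz, zero_smul]
  -- The integrand becomes (γ_z a)⋆(γ_z a), which is positive and, at z = 1, equal to a⋆a ≠ 0.
  · simp only [map_mul, map_star]
    refine integral_star_mul_self_ne_zero (T.continuous_gauge hT hγ a) (x₀ := 1) ?_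
    rwa [T.gauge_one hT hγ]

end Gauge

end TwistedFamily

end KGraph

/-! ### Closed ideals and simplicity -/

theorem TwoSidedIdeal.mem_of_norm_sub_lt {A : Type v} [NonUnitalCStarAlgebra A]
    {I : TwoSidedIdeal A} (hI : IsClosed {x : A | x ∈ I}) {e d : A} (he : e * e = e)
    (hn : ‖e‖ ≤ 1) {c : ℂ} (hd : d ∈ I) (h : ‖d - c • e‖ < ‖c‖) : e ∈ I := by
  have hc : c ≠ 0 := by
    rintro rfl
    rw [norm_zero] at h
    exact h.not_ge (norm_nonneg _)
  -- Here e ≡ r modulo I and ‖r‖ < 1. As e is idempotent, e ≡ r^n for every n ≥ 1, and r^n → 0;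
  -- closedness of I gives e ∈ I.
  set r := e - (c⁻¹ • e) * d with hr
  have hr1 : ‖r‖ < 1 := by
    have h1 : r = -(c⁻¹ • (e * (d - c • e))) := by
      rw [mul_sub, mul_smul_comm, he, smul_sub, smul_smul, inv_mul_cancel₀ hc, one_smul, hr,
        smul_mul_assoc, neg_sub]
    rw [h1, norm_neg, norm_smul, norm_inv, inv_mul_lt_one₀ (norm_pos_iff.2 hc)]
    exact ((norm_mul_le _ _).trans (mul_le_of_le_one_left (norm_nonneg _) hn)).trans_lt h
  -- s n is the power r^(n+1): without a unit in A the powers begin at r.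
  let s : ℕ → A := fun n => Nat.rec r (fun _ x => x * r) n
  have hs : ∀ n, e - s n ∈ I := by
    intro n
    induction n with
    | zero =>
      change e - r ∈ I
      rw [hr, sub_sub_cancel]
      exact I.mul_mem_left _ _ hd
    | succ n ih =>
      change e - s n * r ∈ I
      have : e - s n * r = (e - s n) * r + e * (e - r) := by
        rw [sub_mul, mul_sub e e r, he]
        abel
      rw [this]
      refine I.add_mem (I.mul_mem_right _ _ ih) (I.mul_mem_left _ _ ?_)
      rw [hr, sub_sub_cancel]
      exact I.mul_mem_left _ _ hd
  have hs0 : Filter.Tendsto s Filter.atTop (nhds 0) := by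
    refine squeeze_zero_norm (a := fun n => ‖r‖ ^ (n + 1)) (fun n => ?_)
      ((tendsto_pow_atTop_nhds_zero_of_lt_one (norm_nonneg r) hr1).comp
        (Filter.tendsto_add_atTop_nat 1))
    induction n with
    | zero => exact (pow_one ‖r‖).ge
    | succ n ih =>
      rw [pow_succ]
      exact (norm_mul_le _ _).trans (mul_le_mul_of_nonneg_right ih (norm_nonneg r))
  have h3 : Filter.Tendsto (fun n => e - s n) Filter.atTop (nhds (e - 0)) :=
    tendsto_const_nhds.sub hs0
  rw [sub_zero] at h3
  exact hI.mem_of_tendsto h3 (Filter.Eventually.of_forall hs)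

namespace KGraph.TwistedFamily

variable {k : ℕ} {Λ : KGraph.{u} k} {A : Type v} [NonUnitalCStarAlgebra A]
  (T : TwistedFamily Λ A)

theorem id_mem_of_id_mem (hΛ : Λ.RowFinite) (hcof : Λ.Cofinal) (I : TwoSidedIdeal A) {v : Λ.Obj}
    (hv : T.toFun (𝟙 v) ∈ I) (w : Λ.Obj) : T.toFun (𝟙 w) ∈ I := by
  obtain ⟨n, hn⟩ := hcof v w
  have := hΛ w n
  have := Fintype.ofFinite (Λ.PathsTo w n)
  rw [T.sum w n, finsum_eq_sum_of_fintype]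
  refine sum_mem fun x _ => I.mul_mem_right _ _ ?_
  obtain ⟨f⟩ := hn x
  -- The projection at s(x) is t_f⋆ t_v t_f, which lies in I because t_v does.
  rw [← T.mul_id x.1.2, ← T.star_mul_self f, ← T.id_mul f]
  exact I.mul_mem_left _ _ (I.mul_mem_left _ _ (I.mul_mem_right _ _ hv))

theorem eq_top_of_id_mem {I : TwoSidedIdeal A} (hI : IsClosed {x : A | x ∈ I})
    (hT : T.polynomials.topologicalClosure = ⊤) (h : ∀ v, T.toFun (𝟙 v) ∈ I) : I = ⊤ := by
  have h1 : ∀ x ∈ T.polynomials, x ∈ I := by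
    intro x hx
    refine Submodule.iSup_induction _ (motive := fun x => x ∈ I) hx ?_ I.zero_mem
      fun _ _ => I.add_mem
    intro p x hx
    -- I is only an ideal of rings, so stability under scalars is carried through the induction; for
    -- a generator, the scalar is absorbed into t_f.
    suffices h : ∀ c : ℂ, c • x ∈ I by simpa using h 1
    induction hx using Submodule.span_induction with
    | mem x hx =>
      obtain ⟨a, b, c, f, g, -, -, rfl⟩ := hx
      intro z
      rw [← T.mul_id f, ← smul_mul_assoc, ← smul_mul_assoc]
      exact I.mul_mem_right _ _ (I.mul_mem_left _ _ (h a))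
    | zero => simp
    | add x y _ _ hx hy => exact fun z => smul_add z x y ▸ I.add_mem (hx z) (hy z)
    | smul c x _ hx => exact fun z => smul_smul z c x ▸ hx (z * c)
  refine TwoSidedIdeal.ext fun x => ⟨fun _ => TwoSidedIdeal.mem_top _, fun _ => ?_⟩
  have hx : x ∈ T.polynomials.topologicalClosure := by rw [hT]; trivial
  exact closure_minimal (fun y hy => h1 y hy) hI hx

/-- The uniqueness theorem for twisted Cuntz–Krieger families with a gauge action, and the
simplicity that it implies. -/
theorem isSimple [Nontrivial A] (hΛ : Λ.RowFinite) (hap : Λ.Aperiodic) (hcof : Λ.Cofinal)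
    {γ : (Fin k → Circle) → A →⋆ₙₐ[ℂ] A} (hT : T.polynomials.topologicalClosure = ⊤)
    (hγ : ∀ z {a b c : Λ.Obj} (f : a ⟶ b) (g : a ⟶ c), γ z (T.toFun f * star (T.toFun g)) =
      (gaugeChar (Λ.deg f) (Λ.deg g) z : ℂ) • (T.toFun f * star (T.toFun g))) :
    IsSimpleCStarAlgebra A := by
  classical
  refine ⟨inferInstance, fun I hI => or_iff_not_imp_left.2 fun hne => ?_⟩
  obtain ⟨a, haI, ha⟩ : ∃ a ∈ I, a ≠ 0 := by
    by_contra! h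
    exact hne (TwoSidedIdeal.ext fun x => ⟨fun hx => (TwoSidedIdeal.mem_bot A).2 (h x hx),
      fun hx => (TwoSidedIdeal.mem_bot A).1 hx ▸ I.zero_mem⟩)
  obtain ⟨Φ, hΦ, hadd, hdiag, hoff, hfaith⟩ :=
    T.exists_expectation hT fun z m n x hx => T.gauge_apply_of_mem_bidegree hγ z hx
  set x := star a * a with hx
  have hxI : x ∈ I := I.mul_mem_left _ _ haI
  have hδ : 0 < ‖Φ x‖ := norm_pos_iff.2 (hfaith a ha)
  -- With error below ‖Φ x‖/4 one has ‖Φ y‖ > ‖Φ x‖/2, leaving a scalar c with |c| > ‖Φ x‖/2, larger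
  -- than the error.
  obtain ⟨y, hy, hxy⟩ := T.exists_polynomial_near hT x (ε := ‖Φ x‖ / 4) (by positivity)
  obtain ⟨F, hF, rfl⟩ := (Submodule.mem_iSup_iff_exists_finsupp _ _).1 hy
  have hΦ0 : Φ 0 = 0 := hdiag 0 0 (Submodule.zero_mem _)
  have hΦsum : ∀ s : Finset ((Fin k → ℕ) × (Fin k → ℕ)),
      Φ (∑ p ∈ s, F p) = ∑ p ∈ s with p.1 = p.2, F p := by
    intro s
    induction s using Finset.induction_on with
    | empty => simpa using hΦ0
    | insert p s hp ih =>
      rw [Finset.sum_insert hp, hadd, ih, Finset.filter_insert]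
      split_ifs with h
      · rw [Finset.sum_insert (by simp [hp]), hdiag p.1 _ (by simpa only [← h] using hF p)]
      · rw [hoff _ _ h _ (hF p), zero_add]
  set y := F.sum fun _ x => x with hydef
  have hyΦ : Φ y = ∑ p ∈ F.support with p.1 = p.2, F p := hΦsum F.support
  -- A degree above all first degrees: each diagonal term can be lifted to bidegree (N, N).
  let N := F.support.sup Prod.fst
  have hyN : Φ y ∈ T.bidegree N N := by
    rw [hyΦ]
    refine Submodule.sum_mem _ fun p hp => ?_
    obtain ⟨hp, hp'⟩ := Finset.mem_filter.1 hp
    have h1 := T.bidegree_le_add hΛ p.1 p.2 (N - p.1) (hF p)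
    rwa [← hp', add_tsub_cancel_of_le (Finset.le_sup (f := Prod.fst) hp)] at h1
  have hyn : ‖Φ x‖ / 2 < ‖Φ y‖ := by
    have h1 := hΦ x y
    have h2 := norm_sub_norm_le (Φ x) (Φ y)
    linarith
  obtain ⟨v, X, Z, c, hX, hZ, hX1, hZ1, hc, hXZ⟩ :=
    T.exists_compress_of_mem_bidegree hyN (by positivity) hyn
  obtain ⟨u, l, hl⟩ := T.exists_compress_eq_zero_of_finset hΛ hap v
    (F.support.filter fun p => p.1 ≠ p.2) fun p hp => (Finset.mem_filter.1 hp).2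
  let C : A →+ A :=
    { toFun := fun b => star (T.toFun l) * (star X * b * Z) * T.toFun l
      map_zero' := by simp
      map_add' := fun b b' => by simp only [mul_add, add_mul] }
  have hCy : C y = c • T.toFun (𝟙 u) := by
    have h1 : y = Φ y + ∑ p ∈ F.support with ¬ p.1 = p.2, F p := by
      rw [hyΦ, Finset.sum_filter_add_sum_filter_not]
      rfl
    rw [h1, map_add, map_sum, Finset.sum_eq_zero, add_zero]
    · change star (T.toFun l) * (star X * Φ y * Z) * T.toFun l = _
      rw [hXZ, mul_smul_comm, smul_mul_assoc, mul_assoc, T.id_mul, T.star_mul_self]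
    · intro p hp
      -- The compression by X and Z has not changed the bidegree p, so the path l chosen for p
      -- applies.
      exact hl p hp _ (T.star_mul_mul_mem_bidegree_of_fromVertex hΛ hX hZ (hF p))
  have hl1 : ‖T.toFun l‖ ≤ 1 := by
    have h1 := T.norm_id_le u
    rw [← T.star_mul_self l, CStarRing.norm_star_mul_self] at h1
    nlinarith [norm_nonneg (T.toFun l)]
  have hCn : ∀ b, ‖C b‖ ≤ ‖b‖ := by
    intro b
    calc ‖star (T.toFun l) * (star X * b * Z) * T.toFun l‖
        ≤ ‖star (T.toFun l)‖ * (‖star X‖ * ‖b‖ * ‖Z‖) * ‖T.toFun l‖ := by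
          refine (norm_mul_le _ _).trans (mul_le_mul_of_nonneg_right ?_ (norm_nonneg _))
          refine (norm_mul_le _ _).trans (mul_le_mul_of_nonneg_left ?_ (norm_nonneg _))
          exact (norm_mul_le _ _).trans
            (mul_le_mul_of_nonneg_right (norm_mul_le _ _) (norm_nonneg _))
      _ ≤ 1 * (1 * ‖b‖ * 1) * 1 := by
          rw [norm_star, norm_star]
          gcongr
      _ = ‖b‖ := by ring
  have hCI : C x ∈ I :=
    I.mul_mem_right _ _ (I.mul_mem_left _ _ (I.mul_mem_right _ _ (I.mul_mem_left _ _ hxI)))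
  have hu : T.toFun (𝟙 u) ∈ I := by
    -- ‖C x − c t_u‖ = ‖C (x − y)‖ ≤ ‖x − y‖ < ‖Φ x‖/4 < |c|.
    refine TwoSidedIdeal.mem_of_norm_sub_lt hI (T.mul_id _) (T.norm_id_le u) hCI (c := c) ?_
    rw [← hCy, ← map_sub]
    have := hCn (x - y)
    linarith
  exact T.eq_top_of_id_mem hI hT (T.id_mem_of_id_mem hΛ hcof I hu)

end KGraph.TwistedFamily

/-! ### Operators on ℓ² given by injections -/

section Restriction

open scoped Classical in
/-- The canonical basis vector of `ℓ²(X)` at `x`. -/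
def deltaVec {X : Type u} (x : X) : lp (fun _ : X => ℂ) 2 := lp.single 2 x 1

theorem ext_deltaVec {X : Type u} {E : Type v} [NormedAddCommGroup E] [NormedSpace ℂ E]
    {S T : lp (fun _ : X => ℂ) 2 →L[ℂ] E} (h : ∀ x, S (deltaVec x) = T (deltaVec x)) : S = T := by
  classical
  refine lp.ext_continuousLinearMap (by simp) fun x => ContinuousLinearMap.ext_ring ?_
  simp only [ContinuousLinearMap.comp_apply, lp.singleContinuousLinearMap_apply]
  convert h x using 2 <;> rw [deltaVec]

theorem inner_deltaVec {X : Type u} (x : X) (f : lp (fun _ : X => ℂ) 2) :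
    inner ℂ (deltaVec x) f = f x := by
  classical
  have := lp.inner_single_left (𝕜 := ℂ) (G := fun _ : X => ℂ) x 1 f
  simp only [deltaVec]
  convert this using 1
  simp

theorem deltaVec_apply_self {X : Type u} (x : X) : deltaVec x x = 1 := by
  classical
  exact lp.single_apply_self 2 x 1

theorem deltaVec_apply_of_ne {X : Type u} {x y : X} (h : y ≠ x) : deltaVec x y = 0 := by
  classical
  exact lp.single_apply_ne 2 x 1 h

variable {X Y Z : Type u}

theorem summable_norm_sq_lp {X : Type v} {H : Type w} [NormedAddCommGroup H]
    (f : lp (fun _ : X => H) 2) : Summable fun x => ‖f x‖ ^ (2 : ℝ) := by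
  have := (lp.memℓp f).summable (by simp)
  simpa using this

/-- Restriction of functions along an injective map, as an operator on `ℓ²`. -/
def restrictL2 (i : Y → X) (hi : i.Injective) :
    lp (fun _ : X => ℂ) 2 →L[ℂ] lp (fun _ : Y => ℂ) 2 :=
  LinearMap.mkContinuous
    { toFun := fun f => ⟨fun y => f (i y), memℓp_gen (by
        simpa [Function.comp_def] using (summable_norm_sq_lp f).comp_injective hi)⟩
      map_add' := fun f g => rfl
      map_smul' := fun c f => rfl } 1 fun f => by
    rw [one_mul]
    refine lp.norm_le_of_forall_sum_le (by simp) (norm_nonneg _) fun s => ?_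
    have h1 := lp.sum_rpow_le_norm_rpow (p := 2) (by simp) f (s.map ⟨i, hi⟩)
    rwa [Finset.sum_map] at h1

theorem restrictL2_apply (i : Y → X) (hi : i.Injective) (f : lp (fun _ : X => ℂ) 2) (y : Y) :
    restrictL2 i hi f y = f (i y) := rfl

/-- The adjoint of restriction is extension by zero, an isometry; its values on basis vectors are
all that the later operator identities use. -/
theorem adjoint_restrictL2_deltaVec (i : Y → X) (hi : i.Injective) (y : Y) :
    (restrictL2 i hi).adjoint (deltaVec y) = deltaVec (i y) := by
  refine ext_inner_right ℂ fun f => ?_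
  rw [ContinuousLinearMap.adjoint_inner_left, inner_deltaVec, inner_deltaVec, restrictL2_apply]

theorem restrictL2_deltaVec (i : Y → X) (hi : i.Injective) (y : Y) :
    restrictL2 i hi (deltaVec (i y)) = deltaVec y := by
  refine lp.ext (funext fun z => ?_)
  rw [restrictL2_apply]
  by_cases h : z = y
  · rw [h, deltaVec_apply_self, deltaVec_apply_self]
  · rw [deltaVec_apply_of_ne h, deltaVec_apply_of_ne fun h' => h (hi h')]

theorem restrictL2_deltaVec_of_notMem (i : Y → X) (hi : i.Injective) {x : X}
    (hx : ∀ y, i y ≠ x) : restrictL2 i hi (deltaVec x) = 0 := by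
  refine lp.ext (funext fun z => ?_)
  rw [restrictL2_apply, deltaVec_apply_of_ne (hx z)]
  rfl

theorem restrictL2_comp_adjoint (i : Y → X) (hi : i.Injective) :
    restrictL2 i hi ∘L (restrictL2 i hi).adjoint = ContinuousLinearMap.id ℂ _ :=
  ext_deltaVec fun y => by
    rw [ContinuousLinearMap.comp_apply, adjoint_restrictL2_deltaVec, restrictL2_deltaVec]
    rfl

theorem restrictL2_comp_adjoint_of_disjoint (i : Y → X) (hi : i.Injective) (j : Z → X)
    (hj : j.Injective) (h : ∀ y z, i y ≠ j z) :
    restrictL2 i hi ∘L (restrictL2 j hj).adjoint = 0 :=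
  ext_deltaVec fun z => by
    rw [ContinuousLinearMap.comp_apply, adjoint_restrictL2_deltaVec,
      restrictL2_deltaVec_of_notMem i hi fun y => h y z]
    rfl

end Restriction

/-! ### Cuntz–Krieger families from actions of paths -/

namespace KGraph

variable {k : ℕ} (Λ : KGraph.{u} k)

/-- An action of the paths of `Λ` on sets by injective maps, such that the set over each vertex
`w` is the disjoint union of the images of the paths in `wΛⁿ`, for each `n`. -/
structure PathAction where
  set : Λ.Obj → Type u
  map : ∀ {u v : Λ.Obj}, (u ⟶ v) → set u → set v
  map_id : ∀ (v : Λ.Obj) (x : set v), map (𝟙 v) x = x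
  map_comp : ∀ {u v w : Λ.Obj} (f : u ⟶ v) (g : v ⟶ w) (x : set u), map (f ≫ g) x = map g (map f x)
  injective : ∀ {u v : Λ.Obj} (f : u ⟶ v), (map f).Injective
  surj : ∀ (w : Λ.Obj) (n : Fin k → ℕ) (x : set w), ∃ (p : Λ.PathsTo w n) (y : set p.1.1),
    map p.1.2 y = x
  disjoint : ∀ {w : Λ.Obj} {n : Fin k → ℕ} (p q : Λ.PathsTo w n) (x : set p.1.1) (y : set q.1.1),
    map p.1.2 x = map q.1.2 y → p = q

namespace PathAction

variable {Λ} (S : PathAction Λ)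

/-- The map that a path gives into the disjoint union of all the sets acted upon. -/
def incl {u v : Λ.Obj} (f : u ⟶ v) (x : S.set u) : Σ v, S.set v := ⟨v, S.map f x⟩

theorem incl_injective {u v : Λ.Obj} (f : u ⟶ v) : (S.incl f).Injective := fun x y h => by
  obtain ⟨-, h⟩ := Sigma.mk.inj_iff.1 h
  exact S.injective f (eq_of_heq h)

theorem incl_comp {u v w : Λ.Obj} (f : u ⟶ v) (g : v ⟶ w) :
    S.incl (f ≫ g) = S.incl g ∘ S.map f :=
  funext fun x => Sigma.ext rfl (heq_of_eq (S.map_comp f g x))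

/-- Restriction along the map given by a path. -/
def res {u v : Λ.Obj} (f : u ⟶ v) :
    lp (fun _ : Σ v, S.set v => ℂ) 2 →L[ℂ] lp (fun _ : S.set u => ℂ) 2 :=
  restrictL2 (S.incl f) (S.incl_injective f)

theorem res_comp {u v w : Λ.Obj} (f : u ⟶ v) (g : v ⟶ w) :
    S.res (f ≫ g) = restrictL2 (S.map f) (S.injective f) ∘L S.res g := by
  simp only [res, S.incl_comp]
  rfl

theorem res_comp_adjoint {u v : Λ.Obj} (f : u ⟶ v) :
    S.res f ∘L (S.res f).adjoint = ContinuousLinearMap.id ℂ _ := restrictL2_comp_adjoint _ _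

/-- Restriction along f is restriction to the set over v followed by restriction along `S.map f`.
This identity is what makes `op` multiplicative. -/
theorem res_id_comp_adjoint {u v : Λ.Obj} (f : u ⟶ v) :
    S.res (𝟙 v) ∘L (S.res f).adjoint = (restrictL2 (S.map f) (S.injective f)).adjoint := by
  have h := S.res_comp f (𝟙 v)
  rw [Category.comp_id] at h
  rw [h, ContinuousLinearMap.adjoint_comp, ← ContinuousLinearMap.comp_assoc, S.res_comp_adjoint,
    ContinuousLinearMap.id_comp]

/-- The operator on `ℓ²` by which a path acts. -/
def op {u v : Λ.Obj} (f : u ⟶ v) :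
    lp (fun _ : Σ v, S.set v => ℂ) 2 →L[ℂ] lp (fun _ : Σ v, S.set v => ℂ) 2 :=
  (S.res f).adjoint ∘L S.res (𝟙 u)

theorem op_id_deltaVec_self {v : Λ.Obj} (x : S.set v) :
    S.op (𝟙 v) (deltaVec ⟨v, x⟩) = deltaVec ⟨v, x⟩ := by
  have h : (⟨v, x⟩ : Σ v, S.set v) = S.incl (𝟙 v) x := Sigma.ext rfl (heq_of_eq (S.map_id v x).symm)
  rw [h, op, ContinuousLinearMap.comp_apply, res, restrictL2_deltaVec,
    adjoint_restrictL2_deltaVec]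

theorem star_op {u v : Λ.Obj} (f : u ⟶ v) : star (S.op f) = (S.res (𝟙 u)).adjoint ∘L S.res f := by
  rw [ContinuousLinearMap.star_eq_adjoint, op, ContinuousLinearMap.adjoint_comp,
    ContinuousLinearMap.adjoint_adjoint]

theorem op_mul_star_op {u v : Λ.Obj} (f : u ⟶ v) :
    S.op f * star (S.op f) = (S.res f).adjoint ∘L S.res f := by
  rw [star_op]
  change ((S.res f).adjoint ∘L S.res (𝟙 u)) ∘L ((S.res (𝟙 u)).adjoint ∘L S.res f) = _
  rw [ContinuousLinearMap.comp_assoc, ← ContinuousLinearMap.comp_assoc (S.res (𝟙 u)),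
    S.res_comp_adjoint, ContinuousLinearMap.id_comp]

theorem star_op_mul_op {u v : Λ.Obj} (f : u ⟶ v) : star (S.op f) * S.op f = S.op (𝟙 u) := by
  rw [star_op]
  change ((S.res (𝟙 u)).adjoint ∘L S.res f) ∘L ((S.res f).adjoint ∘L S.res (𝟙 u)) = _
  rw [ContinuousLinearMap.comp_assoc, ← ContinuousLinearMap.comp_assoc (S.res f),
    S.res_comp_adjoint, ContinuousLinearMap.id_comp]
  rfl

theorem op_mul_op {u v w : Λ.Obj} (f : u ⟶ v) (g : v ⟶ w) : S.op g * S.op f = S.op (f ≫ g) := by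
  change ((S.res g).adjoint ∘L S.res (𝟙 v)) ∘L ((S.res f).adjoint ∘L S.res (𝟙 u)) = _
  rw [ContinuousLinearMap.comp_assoc, ← ContinuousLinearMap.comp_assoc (S.res (𝟙 v)),
    S.res_id_comp_adjoint, op, S.res_comp, ContinuousLinearMap.adjoint_comp,
    ContinuousLinearMap.comp_assoc]

theorem adjoint_res_res_incl {u v : Λ.Obj} (f : u ⟶ v) (x : S.set u) :
    (S.res f).adjoint (S.res f (deltaVec (S.incl f x))) = deltaVec (S.incl f x) := by
  rw [res, restrictL2_deltaVec, adjoint_restrictL2_deltaVec]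

theorem adjoint_res_res_of_notMem {u v : Λ.Obj} (f : u ⟶ v) {x : Σ v, S.set v}
    (h : ∀ y, S.incl f y ≠ x) : (S.res f).adjoint (S.res f (deltaVec x)) = 0 := by
  rw [res, restrictL2_deltaVec_of_notMem _ _ h, map_zero]

/-- The Cuntz–Krieger family on `ℓ²` that comes from an action. -/
def family (hΛ : Λ.RowFinite) : CKFamily Λ
    (lp (fun _ : Σ v, S.set v => ℂ) 2 →L[ℂ] lp (fun _ : Σ v, S.set v => ℂ) 2) where
  toFun := S.op
  proj v :=
    { isIdempotentElem := (S.op_mul_op (𝟙 v) (𝟙 v)).trans (by rw [Category.id_comp])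
      isSelfAdjoint := S.star_op (𝟙 v) }
  orth v w h := by
    have h1 : S.res (𝟙 v) ∘L (S.res (𝟙 w)).adjoint = 0 :=
      restrictL2_comp_adjoint_of_disjoint _ _ _ _ fun x y e => h (congrArg Sigma.fst e)
    change ((S.res (𝟙 v)).adjoint ∘L S.res (𝟙 v)) ∘L ((S.res (𝟙 w)).adjoint ∘L S.res (𝟙 w)) = 0
    rw [ContinuousLinearMap.comp_assoc, ← ContinuousLinearMap.comp_assoc (S.res (𝟙 v)), h1,
      ContinuousLinearMap.zero_comp, ContinuousLinearMap.comp_zero]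
  comp := S.op_mul_op
  star_mul_self := S.star_op_mul_op
  sum w n := by
    have := hΛ w n
    have := Fintype.ofFinite (Λ.PathsTo w n)
    rw [finsum_eq_sum_of_fintype]
    simp only [op_mul_star_op]
    -- A basis vector over w lies in the image of exactly one path in wΛⁿ, so exactly one summand
    -- fixes it; all others vanish on it.
    refine ext_deltaVec fun z => ?_
    rw [sum_apply]
    simp only [op, ContinuousLinearMap.comp_apply]
    obtain ⟨v, z⟩ := z
    by_cases hv : v = w
    · subst hv
      have h1 := S.op_id_deltaVec_self z
      rw [op, ContinuousLinearMap.comp_apply] at h1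
      rw [h1]
      obtain ⟨p, y, rfl⟩ := S.surj v n z
      rw [Finset.sum_eq_single p]
      · exact (S.adjoint_res_res_incl p.1.2 y).symm
      · intro q _ hq
        refine S.adjoint_res_res_of_notMem q.1.2 fun x hx => hq ?_
        obtain ⟨-, hx⟩ := Sigma.mk.inj_iff.1 hx
        exact S.disjoint q p x y (eq_of_heq hx)
      · simp
    · have h1 : ∀ {u : Λ.Obj} (f : u ⟶ w),
          (S.res f).adjoint (S.res f (deltaVec ⟨v, z⟩)) = 0 := fun f =>
        S.adjoint_res_res_of_notMem f fun x hx => hv (congrArg Sigma.fst hx).symm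
      rw [h1, Finset.sum_eq_zero fun p _ => h1 p.1.2]

theorem family_id_ne_zero (hΛ : Λ.RowFinite) {v : Λ.Obj} (x : S.set v) :
    (S.family hΛ).toFun (𝟙 v) ≠ 0 := by
  intro h
  have h1 := S.op_id_deltaVec_self x
  rw [show S.op (𝟙 v) = 0 from h] at h1
  have h2 := deltaVec_apply_self (⟨v, x⟩ : Σ v, S.set v)
  rw [← h1] at h2
  exact zero_ne_one h2

end PathAction

end KGraph

/-! ### Infinite paths and a nonzero Cuntz–Krieger family -/

namespace KGraph

variable {k : ℕ} {Λ : KGraph.{u} k}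

theorem comp_right_cancel {u v w : Λ.Obj} {f f' : u ⟶ v} {g : v ⟶ w} (h : f ≫ g = f' ≫ g) :
    f = f' := by
  have hd : Λ.deg f' = Λ.deg f := by
    have := congrArg Λ.deg h
    rw [Λ.deg_comp, Λ.deg_comp] at this
    exact (add_left_cancel this).symm
  have h1 := (Λ.factorization (f ≫ g) _ _ (Λ.deg_comp f g)).unique
    (y₁ := ⟨v, f, g⟩) (y₂ := ⟨v, f', g⟩) ⟨rfl, rfl, rfl⟩ ⟨h.symm, rfl, hd⟩
  simpa using h1

variable (Λ) in
/-- An infinite path of `Λ`, given by a sequence of composable paths of degree `(1, …, 1)`. -/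
structure InfinitePath where
  vert : ℕ → Λ.Obj
  edge : ∀ n, vert (n + 1) ⟶ vert n
  deg_edge : ∀ n, Λ.deg (edge n) = 1

theorem exists_infinitePath (hns : Λ.NoSources) [Nonempty Λ.Obj] : Nonempty (InfinitePath Λ) := by
  have h : ∀ v : Λ.Obj, ∃ (w : Λ.Obj) (f : w ⟶ v), Λ.deg f = 1 := fun v => by
    obtain ⟨⟨⟨w, f⟩, hf⟩⟩ := hns v 1
    exact ⟨w, f, hf⟩
  choose s f hf using h
  exact ⟨⟨fun n => Nat.rec (Classical.arbitrary Λ.Obj) (fun _ v => s v) n, fun n => f _,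
    fun n => hf _⟩⟩

namespace InfinitePath

variable (P : InfinitePath Λ)

/-- The segments of an infinite path. -/
def seg {j l : ℕ} (h : j ≤ l) : P.vert l ⟶ P.vert j :=
  (Functor.ofOpSequence P.edge).map (homOfLE h).op

theorem seg_comp {i j l : ℕ} (h : i ≤ j) (h' : j ≤ l) :
    P.seg h' ≫ P.seg h = P.seg (h.trans h') :=
  ((Functor.ofOpSequence P.edge).map_comp (homOfLE h').op (homOfLE h).op).symm

theorem deg_seg {j l : ℕ} (h : j ≤ l) : Λ.deg (P.seg h) = fun _ => l - j := by
  induction l, h using Nat.le_induction with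
  | base =>
    have : P.seg (le_refl j) = 𝟙 _ := (Functor.ofOpSequence P.edge).map_id _
    rw [this, Λ.deg_id]
    funext i
    simp
  | succ l h ih =>
    rw [← P.seg_comp h (Nat.le_add_right l 1), Λ.deg_comp, ih]
    have : P.seg (Nat.le_add_right l 1) = P.edge l :=
      Functor.ofOpSequence_map_homOfLE_succ P.edge l
    rw [this, P.deg_edge]
    funext i
    simp only [Pi.add_apply, Pi.one_apply]
    omega

/-- Paths with source on the infinite path are identified if they agree after composition with
segments of the infinite path. -/
def setoid (w : Λ.Obj) : Setoid (Σ j : ℕ, (P.vert j ⟶ w)) where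
  r x y := ∃ (l : ℕ) (h : x.1 ≤ l) (h' : y.1 ≤ l), P.seg h ≫ x.2 = P.seg h' ≫ y.2
  iseqv :=
    { refl := fun x => ⟨x.1, le_rfl, le_rfl, rfl⟩
      symm := fun ⟨l, h, h', e⟩ => ⟨l, h', h, e.symm⟩
      trans := by
        rintro x y z ⟨l, h, h', e⟩ ⟨l', i, i', e'⟩
        refine ⟨max l l', h.trans (le_max_left _ _), i'.trans (le_max_right _ _), ?_⟩
        rw [← P.seg_comp h (le_max_left _ _), ← P.seg_comp i' (le_max_right _ _), Category.assoc,
          Category.assoc, e, ← e', ← Category.assoc, ← Category.assoc, P.seg_comp, P.seg_comp] }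

theorem mk_seg_comp {w : Λ.Obj} {j l : ℕ} (h : j ≤ l) (f : P.vert j ⟶ w) :
    (Quotient.mk (P.setoid w) ⟨j, f⟩) = Quotient.mk (P.setoid w) ⟨l, P.seg h ≫ f⟩ :=
  Quotient.sound ⟨l, h, le_rfl, by rw [← Category.assoc, P.seg_comp]⟩

/-- The action of the paths of `Λ` on the infinite paths that share a tail with a given one. -/
def action : PathAction Λ where
  set w := Quotient (P.setoid w)
  map f := Quotient.map (fun x => ⟨x.1, x.2 ≫ f⟩) (by
    rintro x y ⟨l, h, h', e⟩
    exact ⟨l, h, h', by rw [← Category.assoc, e, Category.assoc]⟩)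
  map_id v x := by
    induction x using Quotient.inductionOn with
    | h x => simp [Quotient.map_mk]
  map_comp f g x := by
    induction x using Quotient.inductionOn with
    | h x => simp [Quotient.map_mk]
  injective f := by
    intro x y
    induction x using Quotient.inductionOn with
    | h x =>
      induction y using Quotient.inductionOn with
      | h y =>
        intro e
        obtain ⟨l, h, h', e⟩ := Quotient.exact e
        refine Quotient.sound ⟨l, h, h', ?_⟩
        rw [← Category.assoc, ← Category.assoc] at e
        exact comp_right_cancel e
  surj w n x := by
    induction x using Quotient.inductionOn with
    | h x =>
      obtain ⟨j, f⟩ := x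
      -- Moving ∑ n_i steps along the infinite path adds at least n_i to every coordinate of the
      -- degree, so a path of degree n can be split off.
      have hl : j ≤ j + ∑ i, n i := Nat.le_add_right _ _
      have hd : n ≤ Λ.deg (P.seg hl ≫ f) := by
        rw [Λ.deg_comp, P.deg_seg]
        intro i
        have := Finset.single_le_sum (f := n) (fun _ _ => Nat.zero_le _) (Finset.mem_univ i)
        simp only [Pi.add_apply]
        omega
      obtain ⟨⟨v, f₂, f₁⟩, ⟨h1, h2, h3⟩, -⟩ :=
        Λ.factorization (P.seg hl ≫ f) n _ (add_tsub_cancel_of_le hd).symm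
      refine ⟨⟨⟨v, f₁⟩, h2⟩, Quotient.mk _ ⟨_, f₂⟩, ?_⟩
      rw [P.mk_seg_comp hl f, ← h1]
      rfl
  disjoint {w n} p q x y := by
    induction x using Quotient.inductionOn with
    | h x =>
      induction y using Quotient.inductionOn with
      | h y =>
        intro e
        obtain ⟨l, h, h', e⟩ := Quotient.exact e
        dsimp only at h h' e
        rw [← Category.assoc, ← Category.assoc] at e
        have hd := congrArg Λ.deg e
        rw [Λ.deg_comp _ p.1.2, Λ.deg_comp _ q.1.2, p.2, q.2] at hd
        -- Both representatives, extended to a common vertex, factor the same path with initial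
        -- degree n.
        have h1 := (Λ.factorization _ n _ (by rw [Λ.deg_comp, q.2])).unique
          (y₁ := ⟨p.1.1, P.seg h ≫ x.2, p.1.2⟩) (y₂ := ⟨q.1.1, P.seg h' ≫ y.2, q.1.2⟩)
          ⟨e, p.2, add_left_cancel hd⟩ ⟨rfl, q.2, rfl⟩
        have h2 := congrArg (fun z : Σ v : Λ.Obj, (P.vert l ⟶ v) × (v ⟶ w) =>
          (⟨z.1, z.2.2⟩ : Σ v : Λ.Obj, (v ⟶ w))) h1
        exact Subtype.ext h2

end InfinitePath

/-- There is a nonzero Cuntz–Krieger `Λ`-family of operators on a Hilbert space. -/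
theorem exists_family_id_ne_zero (hΛ : Λ.RowFinite) (hns : Λ.NoSources) [Nonempty Λ.Obj] :
    ∃ (X : Type u) (T : CKFamily Λ (lp (fun _ : X => ℂ) 2 →L[ℂ] lp (fun _ : X => ℂ) 2))
      (v : Λ.Obj), T.toFun (𝟙 v) ≠ 0 := by
  obtain ⟨P⟩ := exists_infinitePath hns
  exact ⟨_, P.action.family hΛ, P.vert 0, P.action.family_id_ne_zero hΛ
    (Quotient.mk _ ⟨0, 𝟙 (P.vert 0)⟩)⟩

end KGraph

/-! ### Density in generated C⋆-algebras and maps between them -/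

section GeneratedCStar

variable {A : Type u} [NonUnitalCStarAlgebra A]

theorem adjoin_subset_span {S : Set A} (hmul : ∀ x ∈ S, ∀ y ∈ S, x * y ∈ S)
    (hstar : ∀ x ∈ S, star x ∈ S) {x : A} (hx : x ∈ NonUnitalStarAlgebra.adjoin ℂ S) :
    x ∈ Submodule.span ℂ S := by
  induction hx using NonUnitalStarAlgebra.adjoin_induction with
  | mem x hx => exact Submodule.subset_span hx
  | add x y _ _ hx hy => exact Submodule.add_mem _ hx hy
  | zero => exact Submodule.zero_mem _
  | mul x y hx' hy' hx hy =>
    clear hx' hy'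
    induction hx, hy using Submodule.span_induction₂ with
    | mem_mem x y hx hy => exact Submodule.subset_span (hmul x hx y hy)
    | zero_left y hy => simp
    | zero_right x hx => simp
    | add_left x y z _ _ _ hx hy =>
      rw [add_mul]
      exact Submodule.add_mem _ hx hy
    | add_right x y z _ _ _ hx hy =>
      rw [mul_add]
      exact Submodule.add_mem _ hx hy
    | smul_left r x y _ _ h =>
      rw [smul_mul_assoc]
      exact Submodule.smul_mem _ r h
    | smul_right r x y _ _ h =>
      rw [mul_smul_comm]
      exact Submodule.smul_mem _ r h
  | smul r x _ hx => exact Submodule.smul_mem _ r hx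
  | star x hx' hx =>
    clear hx'
    induction hx using Submodule.span_induction with
    | mem x hx => exact Submodule.subset_span (hstar x hx)
    | zero => simp
    | add x y _ _ hx hy =>
      rw [star_add]
      exact Submodule.add_mem _ hx hy
    | smul c x _ hx =>
      rw [star_smul]
      exact Submodule.smul_mem _ _ hx

/-- Since S is stable under products and adjoints, its linear span is already the ∗-algebra it
generates, so M need only be a closed subspace. -/
theorem mem_of_generators {S : Set A} (hmul : ∀ x ∈ S, ∀ y ∈ S, x * y ∈ S)
    (hstar : ∀ x ∈ S, star x ∈ S) {M : Submodule ℂ (generatedCStar S)}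
    (hM : IsClosed (M : Set (generatedCStar S)))
    (h : ∀ x (hx : x ∈ S), (⟨x, subset_generatedCStar S hx⟩ : generatedCStar S) ∈ M)
    (x : generatedCStar S) : x ∈ M := by
  let M' : Submodule ℂ A := M.map (NonUnitalStarSubalgebraClass.subtype (generatedCStar S) :
    generatedCStar S →ₗ[ℂ] A)
  have hM' : IsClosed (M' : Set A) :=
    (generatedCStar.isClosed S).isClosedEmbedding_subtypeVal.isClosedMap _ hM
  have hx : x.1 ∈ closure (NonUnitalStarAlgebra.adjoin ℂ S : Set A) := x.2
  have hS : S ⊆ M' := fun z hz => ⟨⟨z, subset_generatedCStar S hz⟩, h z hz, rfl⟩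
  have h1 : x.1 ∈ M' := closure_minimal (fun y hy =>
    Submodule.span_le.2 hS (adjoin_subset_span hmul hstar hy)) hM' hx
  obtain ⟨y, hy, hyx⟩ := h1
  rwa [← Subtype.ext hyx]

theorem Submodule.mem_of_closure_span {E : Type u} [NormedAddCommGroup E] [NormedSpace ℂ E]
    {S : Set E} {M : Submodule ℂ (Submodule.span ℂ S).topologicalClosure}
    (hM : IsClosed (M : Set (Submodule.span ℂ S).topologicalClosure))
    (h : ∀ x : (Submodule.span ℂ S).topologicalClosure, x.1 ∈ S → x ∈ M)
    (x : (Submodule.span ℂ S).topologicalClosure) : x ∈ M := by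
  have hM' : IsClosed (M.map (Submodule.subtype _) : Set E) :=
    (Submodule.isClosed_topologicalClosure _).isClosedEmbedding_subtypeVal.isClosedMap _ hM
  have hx : x.1 ∈ closure (Submodule.span ℂ S : Set E) := x.2
  have hS : S ⊆ M.map (Submodule.subtype _) := fun z hz =>
    ⟨⟨z, Submodule.le_topologicalClosure _ (Submodule.subset_span hz)⟩, h _ hz, rfl⟩
  obtain ⟨y, hy, hyx⟩ : x.1 ∈ M.map (Submodule.subtype _) :=
    closure_minimal (Submodule.span_le.2 hS) hM' hx
  rwa [← Subtype.ext hyx]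

/-- A homomorphism of C⋆-algebras that maps the generators of one subalgebra into another
restricts to these subalgebras. -/
def restrictGenerated {B : Type v} [NonUnitalCStarAlgebra B] (φ : A →⋆ₙₐ[ℂ] B) {S : Set A}
    {S' : Set B} (h : ∀ x ∈ S, φ x ∈ generatedCStar S') :
    generatedCStar S →⋆ₙₐ[ℂ] generatedCStar S' :=
  NonUnitalStarAlgHom.codRestrict
    (φ.comp (NonUnitalStarSubalgebraClass.subtype (generatedCStar S))) (generatedCStar S') (by
    intro x
    have hφ : Continuous φ :=
      AddMonoidHomClass.continuous_of_bound φ 1 fun x => by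
        simpa using NonUnitalStarAlgHom.norm_apply_le φ x
    have hc : IsClosed (φ ⁻¹' (generatedCStar S' : Set B)) :=
      (generatedCStar.isClosed S').preimage hφ
    have hx : x.1 ∈ closure (NonUnitalStarAlgebra.adjoin ℂ S : Set A) := x.2
    refine closure_minimal (fun y hy => ?_) hc hx
    exact (NonUnitalStarAlgebra.adjoin_le (S := (generatedCStar S').comap φ) h) hy)

/-- The homomorphism between `ℓ^∞`-products given by a map of the indices and homomorphisms
between the factors. -/
def lpReindex {I : Type u} {A : I → Type v} [∀ i, NonUnitalCStarAlgebra (A i)] (r : I → I)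
    (θ : ∀ i, A (r i) →⋆ₙₐ[ℂ] A i) : lp A ∞ →⋆ₙₐ[ℂ] lp A ∞ where
  toFun f := ⟨fun i => θ i (f (r i)), memℓp_infty ⟨‖f‖, by
    rintro _ ⟨i, rfl⟩
    exact (NonUnitalStarAlgHom.norm_apply_le (θ i) _).trans
      (lp.norm_apply_le_norm (by simp) f (r i))⟩⟩
  map_smul' c f := lp.ext (funext fun i => map_smul (θ i) c (f (r i)))
  map_zero' := lp.ext (funext fun i => map_zero (θ i))
  map_add' f g := lp.ext (funext fun i => map_add (θ i) (f (r i)) (g (r i)))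
  map_mul' f g := lp.ext (funext fun i => map_mul (θ i) (f (r i)) (g (r i)))
  map_star' f := lp.ext (funext fun i => map_star (θ i) (f (r i)))

end GeneratedCStar

/-! ### Tensoring operators with the left regular σ-representation -/

section Amplification

variable {G : Type w} [Group G] (σ : TwoCocycle G) {H : Type u} [NormedAddCommGroup H]
  [InnerProductSpace ℂ H]

/-- Left translation on a lift of the group `G`. -/
def liftTranslate (g : G) : ULift.{v} G ≃ ULift.{v} G where
  toFun h := ⟨g⁻¹ * h.down⟩
  invFun h := ⟨g * h.down⟩
  left_inv h := by simp
  right_inv h := by simp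

theorem norm_amplify_apply_le (T : H →L[ℂ] H) (g : G) (f : lp (fun _ : ULift.{v} G => H) 2)
    (h : ULift.{v} G) :
    ‖(σ.toFun g (g⁻¹ * h.down) : ℂ) • T (f (liftTranslate g h))‖ ^ (2 : ℝ) ≤
      ‖T‖ ^ (2 : ℝ) * ‖f (liftTranslate g h)‖ ^ (2 : ℝ) := by
  rw [norm_smul, Circle.norm_coe, one_mul, ← Real.mul_rpow (norm_nonneg _) (norm_nonneg _)]
  exact Real.rpow_le_rpow (norm_nonneg _) (T.le_opNorm _) (by norm_num)

/-- The operator `T ⊗ λ_g` on `ℓ²(G, H)`, where `λ` is the left regular `σ`-representation. -/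
def amplify (T : H →L[ℂ] H) (g : G) :
    lp (fun _ : ULift.{v} G => H) 2 →L[ℂ] lp (fun _ : ULift.{v} G => H) 2 :=
  LinearMap.mkContinuous
    { toFun := fun f => ⟨fun h => (σ.toFun g (g⁻¹ * h.down) : ℂ) • T (f (liftTranslate g h)),
        memℓp_gen (by
          have h1 := ((summable_norm_sq_lp f).comp_injective
            (liftTranslate.{v} g).injective).mul_left (‖T‖ ^ (2 : ℝ))
          simpa using h1.of_nonneg_of_le (fun _ => by positivity)
            fun h => norm_amplify_apply_le σ T g f h)⟩
      map_add' := fun f f' => lp.ext (funext fun h => by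
        exact (congrArg _ (map_add T _ _)).trans (smul_add _ _ _))
      map_smul' := fun c f => lp.ext (funext fun h => by
        exact (congrArg _ (map_smul T c _)).trans (smul_comm _ c _)) } ‖T‖ fun f => by
    refine lp.norm_le_of_forall_sum_le (by simp) (by positivity) fun s => ?_
    have h1 := lp.sum_rpow_le_norm_rpow (p := 2) (by simp) f
      (s.map (liftTranslate.{v} g).toEmbedding)
    rw [Finset.sum_map] at h1
    have h2 := Finset.sum_le_sum fun h (_ : h ∈ s) => norm_amplify_apply_le σ T g f h
    rw [← Finset.mul_sum] at h2
    rw [Real.mul_rpow (norm_nonneg _) (norm_nonneg _)]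
    refine le_trans ?_ (mul_le_mul_of_nonneg_left h1 (by positivity))
    simpa using h2

theorem amplify_apply (T : H →L[ℂ] H) (g : G) (f : lp (fun _ : ULift.{v} G => H) 2)
    (h : ULift.{v} G) :
    amplify σ T g f h = (σ.toFun g (g⁻¹ * h.down) : ℂ) • T (f (liftTranslate g h)) := rfl

theorem amplify_add (S T : H →L[ℂ] H) (g : G) :
    amplify.{u, v} σ (S + T) g = amplify σ S g + amplify σ T g := by
  refine ContinuousLinearMap.ext fun f => lp.ext (funext fun h => ?_)
  exact smul_add _ _ _

theorem amplify_smul (c : ℂ) (T : H →L[ℂ] H) (g : G) :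
    amplify.{u, v} σ (c • T) g = c • amplify σ T g := by
  refine ContinuousLinearMap.ext fun f => lp.ext (funext fun h => ?_)
  exact smul_comm _ c _

/-- At the point l this is the cocycle identity for g, h, h⁻¹g⁻¹l. The factor σ(g,h) is the one in
the deformed product. -/
theorem amplify_mul_amplify (S T : H →L[ℂ] H) (g h : G) :
    amplify.{u, v} σ S g * amplify σ T h = (σ.toFun g h : ℂ) • amplify σ (S * T) (g * h) := by
  refine ContinuousLinearMap.ext fun f => lp.ext (funext fun l => ?_)
  change (σ.toFun g (g⁻¹ * l.down) : ℂ) • S ((σ.toFun h (h⁻¹ * (g⁻¹ * l.down)) : ℂ) •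
    T (f (liftTranslate h (liftTranslate g l)))) = (σ.toFun g h : ℂ) •
      ((σ.toFun (g * h) ((g * h)⁻¹ * l.down) : ℂ) • S (T (f (liftTranslate (g * h) l))))
  have h1 : liftTranslate h (liftTranslate g l) = liftTranslate (g * h) l :=
    ULift.ext _ _ (by simp [liftTranslate, mul_assoc])
  have h2 := σ.cocycle g h (h⁻¹ * (g⁻¹ * l.down))
  rw [mul_inv_cancel_left] at h2
  rw [h1, map_smul, smul_smul, smul_smul, mul_inv_rev, mul_assoc, ← Circle.coe_mul,
    ← Circle.coe_mul, h2]

theorem norm_amplify_le (T : H →L[ℂ] H) (g : G) : ‖amplify.{u, v} σ T g‖ ≤ ‖T‖ :=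
  LinearMap.mkContinuous_norm_le _ (norm_nonneg _) _

/-- As σ(1,·) = 1, T is recovered as a diagonal entry of its amplification. -/
theorem amplify_one_ne_zero {T : H →L[ℂ] H} (hT : T ≠ 0) : amplify.{u, v} σ T 1 ≠ 0 := by
  classical
  intro h
  refine hT (ContinuousLinearMap.ext fun x => ?_)
  have h1 := congrArg (fun S => S (lp.single 2 ⟨1⟩ x) ⟨1⟩) h
  dsimp only at h1
  rw [amplify_apply] at h1
  have h2 : liftTranslate.{v} (1 : G) ⟨1⟩ = ⟨1⟩ := ULift.ext _ _ (by simp [liftTranslate])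
  rw [h2, lp.single_apply_self, σ.one_left, Circle.coe_one, one_smul] at h1
  exact h1

variable [CompleteSpace H]

/-- Reindex the inner product by translation; the phases match by σ(g,g⁻¹) = σ(g,g⁻¹l) σ(g⁻¹,l). -/
theorem star_amplify (T : H →L[ℂ] H) (g : G) :
    star (amplify.{u, v} σ T g) = (conj (σ.toFun g g⁻¹ : ℂ)) • amplify σ (star T) g⁻¹ := by
  rw [ContinuousLinearMap.star_eq_adjoint, eq_comm, ContinuousLinearMap.eq_adjoint_iff]
  intro f f'
  rw [lp.inner_eq_tsum, lp.inner_eq_tsum, ← (liftTranslate.{v} g).tsum_eq]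
  refine tsum_congr fun l => ?_
  have h1 : liftTranslate.{v} g⁻¹ (liftTranslate g l) = l :=
    ULift.ext _ _ (by simp [liftTranslate])
  have h2 : (amplify σ (star T) g⁻¹ f) (liftTranslate.{v} g l) =
      (σ.toFun g⁻¹ l.down : ℂ) • (star T) (f l) := by
    rw [amplify_apply, h1]
    congr 3
    simp [liftTranslate]
  have h3 := σ.cocycle g g⁻¹ l.down
  rw [mul_inv_cancel, σ.one_left, mul_one] at h3
  change inner ℂ (conj (σ.toFun g g⁻¹ : ℂ) • (amplify σ (star T) g⁻¹ f) (liftTranslate g l))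
    (f' (liftTranslate g l)) = inner ℂ (f l) (amplify σ T g f' l)
  rw [h2, amplify_apply, inner_smul_left, inner_smul_left, inner_smul_right, h3,
    ContinuousLinearMap.star_eq_adjoint, ContinuousLinearMap.adjoint_inner_left, Complex.conj_conj,
    Circle.coe_mul, ← mul_assoc]
  congr 1
  rw [mul_assoc, Complex.mul_conj', Circle.norm_coe]
  simp

end Amplification

/-! ### The gauge action on C⋆(Λ), its fibres and their representations -/

namespace KGraph

variable {k : ℕ} {Λ : KGraph.{u} k}

theorem gaugeChar_add_left (m n p : Fin k → ℕ) (z : Fin k → Circle) :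
    gaugeChar (m + n) p z = gaugeChar m 0 z * gaugeChar n p z := by
  simp only [gaugeChar, MonoidHom.coe_mk, OneHom.coe_mk, ← Finset.prod_mul_distrib, ← zpow_add]
  refine Finset.prod_congr rfl fun i _ => ?_
  congr 1
  simp only [Pi.add_apply, Pi.zero_apply]
  push_cast
  ring

theorem gaugeChar_mul_conj (m n : Fin k → ℕ) (z : Fin k → Circle) :
    (gaugeChar m 0 z : ℂ) * conj (gaugeChar n 0 z : ℂ) = gaugeChar m n z := by
  rw [← Circle.coe_inv_eq_conj, ← Circle.coe_mul, ← div_eq_mul_inv]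
  refine congrArg (fun w : Circle => (w : ℂ)) ?_
  simp only [gaugeChar, MonoidHom.coe_mk, OneHom.coe_mk, ← Finset.prod_div_distrib]
  refine Finset.prod_congr rfl fun i _ => ?_
  rw [div_eq_mul_inv, ← zpow_sub]
  congr 1

theorem conj_gaugeChar_mul_self (m n : Fin k → ℕ) (z : Fin k → Circle) :
    conj (gaugeChar m n z : ℂ) * gaugeChar m n z = 1 := by
  rw [Complex.conj_mul', Circle.norm_coe]
  simp

/-- The gauge action on Cuntz–Krieger families. -/
def CKFamily.gauge {A : Type v} [NonUnitalCStarAlgebra A] (T : CKFamily Λ A)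
    (z : Fin k → Circle) : CKFamily Λ A where
  toFun f := (gaugeChar (Λ.deg f) 0 z : ℂ) • T.toFun f
  proj v := by
    rw [Λ.deg_id, gaugeChar_self, Circle.coe_one, one_smul]
    exact T.proj v
  orth v w h := by rw [smul_mul_smul_comm, T.orth v w h, smul_zero]
  comp f g := by
    rw [smul_mul_smul_comm, T.comp, Λ.deg_comp, gaugeChar_add_left, Circle.coe_mul]
  star_mul_self {u v} f := by
    rw [star_smul, smul_mul_smul_comm, T.star_mul_self, Λ.deg_id, gaugeChar_self, Circle.coe_one]
    congr 1
    exact conj_gaugeChar_mul_self _ _ z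
  sum w n := by
    rw [Λ.deg_id, gaugeChar_self, Circle.coe_one, one_smul, T.sum w n]
    refine finsum_congr fun x => ?_
    rw [star_smul, smul_mul_smul_comm, mul_comm]
    have : star (gaugeChar (Λ.deg x.1.2) 0 z : ℂ) * gaugeChar (Λ.deg x.1.2) 0 z = 1 :=
      conj_gaugeChar_mul_self _ _ z
    rw [this, one_smul]

variable (Λ) in
/-- The gauge action on `C⋆(Λ)`. -/
def gaugeHom (z : Fin k → Circle) : Λ.CStar →⋆ₙₐ[ℂ] Λ.CStar :=
  -- The component of the image at a family ρ is the component of the argument at the gauge-twisted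
  -- ρ, a family in the same algebra.
  restrictGenerated
    (lpReindex (fun ρ : CKInto Λ => { alg := ρ.alg, fam := ρ.fam.gauge z })
      fun ρ => NonUnitalStarAlgHom.id ℂ ρ.alg) (by
    rintro _ ⟨u, v, f, rfl⟩
    change (gaugeChar (Λ.deg f) 0 z : ℂ) • Λ.univ f ∈ generatedCStar _
    refine SMulMemClass.smul_mem _ ?_
    exact subset_generatedCStar _ ⟨u, v, f, rfl⟩)

theorem gaugeHom_gen (z : Fin k → Circle) {u v : Λ.Obj} (f : u ⟶ v) :
    Λ.gaugeHom z (Λ.gen f) = (gaugeChar (Λ.deg f) 0 z : ℂ) • Λ.gen f := rfl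

theorem gaugeHom_gen_mul_star (z : Fin k → Circle) {a b c d : Λ.Obj} (f : a ⟶ b) (g : c ⟶ d) :
    Λ.gaugeHom z (Λ.gen f * star (Λ.gen g)) =
      (gaugeChar (Λ.deg f) (Λ.deg g) z : ℂ) • (Λ.gen f * star (Λ.gen g)) := by
  rw [map_mul, map_star, gaugeHom_gen, gaugeHom_gen, star_smul, smul_mul_smul_comm]
  congr 1
  exact gaugeChar_mul_conj _ _ z

variable (hΛ : Λ.RowFinite) {G : Type w} [Group G] (η : Λ.Obj ⥤ SingleObj G)

theorem label_id (v : Λ.Obj) : label η (𝟙 v) = 1 := η.map_id v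

theorem gaugeHom_mem (z : Fin k → Circle) {g : G} {x : Λ.CStar}
    (hx : x ∈ (Λ.canonicalFamily hΛ).spectralSubspace η g) :
    Λ.gaugeHom z x ∈ (Λ.canonicalFamily hΛ).spectralSubspace η g := by
  have hc : Continuous (Λ.gaugeHom z) :=
    AddMonoidHomClass.continuous_of_bound (Λ.gaugeHom z) 1 fun x => by
      simpa using NonUnitalStarAlgHom.norm_apply_le (Λ.gaugeHom z) x
  refine map_mem_closure hc hx fun y hy => ?_
  change y ∈ Submodule.span ℂ _ at hy
  change _ ∈ Submodule.span ℂ _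
  induction hy using Submodule.span_induction with
  | mem y hy =>
    obtain ⟨a, b, c, d, f, f', h, rfl⟩ := hy
    change Λ.gaugeHom z (Λ.gen f * star (Λ.gen f')) ∈ _
    rw [gaugeHom_gen_mul_star]
    exact Submodule.smul_mem _ _ (Submodule.subset_span ⟨a, b, c, d, f, f', h, rfl⟩)
  | zero => simp
  | add x y _ _ hx hy =>
    rw [map_add]
    exact Submodule.add_mem _ hx hy
  | smul c x _ hx =>
    rw [map_smul]
    exact Submodule.smul_mem _ c hx

/-- The gauge action on the fibres of the Fell bundle. -/
def gaugeFiber (z : Fin k → Circle) (g : G) :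
    (Λ.fellBundle hΛ η).fiber g →ₗ[ℂ] (Λ.fellBundle hΛ η).fiber g where
  toFun b := ⟨Λ.gaugeHom z b.1, gaugeHom_mem hΛ η z b.2⟩
  map_add' b c := Subtype.ext (map_add (Λ.gaugeHom z) b.1 c.1)
  map_smul' c b := Subtype.ext (map_smul (Λ.gaugeHom z) c b.1)

/-- The element `s_f s_f'⋆` of the Fell bundle. -/
def mono {a b c d : Λ.Obj} (f : a ⟶ b) (f' : c ⟶ d) {g : G}
    (h : label η f * (label η f')⁻¹ = g) : (Λ.fellBundle hΛ η).fiber g :=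
  ⟨Λ.gen f * star (Λ.gen f'), Submodule.le_topologicalClosure _
    (Submodule.subset_span ⟨a, b, c, d, f, f', h, rfl⟩)⟩

theorem fiber_mem_of_mono {g : G} {M : Submodule ℂ ((Λ.fellBundle hΛ η).fiber g)}
    (hM : IsClosed (M : Set ((Λ.fellBundle hΛ η).fiber g)))
    (h : ∀ {a b c d : Λ.Obj} (f : a ⟶ b) (f' : c ⟶ d) (h : label η f * (label η f')⁻¹ = g),
      mono hΛ η f f' h ∈ M) (b : (Λ.fellBundle hΛ η).fiber g) : b ∈ M := by
  refine Submodule.mem_of_closure_span hM (fun x hx => ?_) b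
  obtain ⟨a, b, c, d, f, f', h1, h2⟩ := hx
  have := h f f' h1
  rwa [show x = mono hΛ η f f' h1 from Subtype.ext h2]

variable (σ : TwoCocycle G)

section GaugeRep

variable {A : Type v} [NonUnitalCStarAlgebra A]

theorem continuous_rep (π : FellBundle.Rep ((Λ.fellBundle hΛ η).deform σ) A) (g : G) :
    Continuous (π.toFun g) :=
  AddMonoidHomClass.continuous_of_bound (π.toFun g) 1 fun x => by
    simpa using π.norm_le g x

/-- The gauge action on representations of the deformed Fell bundle. -/
def gaugeRep (π : FellBundle.Rep ((Λ.fellBundle hΛ η).deform σ) A) (z : Fin k → Circle) :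
    FellBundle.Rep ((Λ.fellBundle hΛ η).deform σ) A where
  toFun g := π.toFun g ∘ₗ gaugeFiber hΛ η z g
  map_mul {g h l} e b c := by
    refine Eq.trans (congrArg (π.toFun l) ?_) (π.map_mul e _ _)
    refine Subtype.ext ?_
    exact (map_smul (Λ.gaugeHom z) (σ.toFun g h : ℂ) (b.1 * c.1)).trans
      (congrArg _ (map_mul (Λ.gaugeHom z) b.1 c.1))
  map_adj {g h} e b := by
    refine Eq.trans (congrArg (π.toFun h) ?_) (π.map_adj e _)
    refine Subtype.ext ?_
    exact (map_smul (Λ.gaugeHom z) (conj (σ.toFun g g⁻¹ : ℂ)) (star b.1)).trans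
      (congrArg _ (map_star (Λ.gaugeHom z) b.1))
  nondegenerate := by
    rw [eq_top_iff, ← π.nondegenerate]
    refine Submodule.topologicalClosure_minimal _ (Submodule.span_le.2 ?_)
      (Submodule.isClosed_topologicalClosure _)
    rintro _ ⟨b, a, rfl⟩
    set M := (Submodule.span ℂ {x : A | ∃ (b : ((Λ.fellBundle hΛ η).deform σ).fiber 1) (a : A),
      x = (π.toFun 1 ∘ₗ gaugeFiber hΛ η z 1) b * a}).topologicalClosure
    -- Monomials are eigenvectors of the gauge action with unimodular eigenvalues; the inverse
    -- eigenvalue can be moved onto a, so π(b)a is again of the required form for monomials b.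
    let N : Submodule ℂ ((Λ.fellBundle hΛ η).fiber 1) :=
      M.comap ((LinearMap.mulRight ℂ a) ∘ₗ π.toFun 1)
    have hN : IsClosed (N : Set ((Λ.fellBundle hΛ η).fiber 1)) :=
      (Submodule.isClosed_topologicalClosure _).preimage
        ((continuous_rep hΛ η σ π 1).mul continuous_const)
    refine fiber_mem_of_mono hΛ η hN (fun f f' h => ?_) b
    refine Submodule.le_topologicalClosure _ (Submodule.subset_span
      ⟨mono hΛ η f f' h, conj (gaugeChar (Λ.deg f) (Λ.deg f') z : ℂ) • a, ?_⟩)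
    have h1 : gaugeFiber hΛ η z 1 (mono hΛ η f f' h) =
        (gaugeChar (Λ.deg f) (Λ.deg f') z : ℂ) • mono hΛ η f f' h :=
      Subtype.ext (gaugeHom_gen_mul_star z f f')
    change π.toFun 1 (mono hΛ η f f' h) * a =
      π.toFun 1 (gaugeFiber hΛ η z 1 (mono hΛ η f f' h)) * _
    rw [h1]
    have h2 : π.toFun 1 ((gaugeChar (Λ.deg f) (Λ.deg f') z : ℂ) • mono hΛ η f f' h) =
      (gaugeChar (Λ.deg f) (Λ.deg f') z : ℂ) • π.toFun 1 (mono hΛ η f f' h) := map_smul _ _ _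
    rw [h2, smul_mul_smul_comm, mul_comm, conj_gaugeChar_mul_self, one_smul]

end GaugeRep

end KGraph

/-! ### The fibres inside the universal algebra -/

namespace FellBundle

variable {G : Type w} [Group G] (B : FellBundle.{v} G)

theorem univ_mul {g h k : G} (e : g * h = k) (b : B.fiber g) (c : B.fiber h) :
    B.univ (B.mul e b c) = B.univ b * B.univ c :=
  lp.ext (funext fun ρ => ρ.rep.map_mul e b c)

theorem univ_adj {g h : G} (e : g⁻¹ = h) (b : B.fiber g) : B.univ (B.adj e b) = star (B.univ b) :=
  lp.ext (funext fun ρ => ρ.rep.map_adj e b)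

/-- The canonical map of a fibre into the C⋆-algebra of the Fell bundle. -/
def canon (g : G) : B.fiber g →ₗ[ℂ] B.CStar where
  toFun b := ⟨B.univ b, subset_generatedCStar _ ⟨g, b, rfl⟩⟩
  map_add' b c := Subtype.ext (lp.ext (funext fun ρ => map_add (ρ.rep.toFun g) b c))
  map_smul' z b := Subtype.ext (lp.ext (funext fun ρ => map_smul (ρ.rep.toFun g) z b))

theorem canon_mul {g h k : G} (e : g * h = k) (b : B.fiber g) (c : B.fiber h) :
    B.canon k (B.mul e b c) = B.canon g b * B.canon h c :=
  Subtype.ext (B.univ_mul e b c)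

theorem canon_adj {g h : G} (e : g⁻¹ = h) (b : B.fiber g) :
    B.canon h (B.adj e b) = star (B.canon g b) :=
  Subtype.ext (B.univ_adj e b)

theorem continuous_canon (g : G) : Continuous (B.canon g) :=
  AddMonoidHomClass.continuous_of_bound (B.canon g) 1 fun b => by
    rw [one_mul]
    exact lp.norm_le_of_forall_le (norm_nonneg b) fun ρ => ρ.rep.norm_le g b

theorem mem_of_canon {M : Submodule ℂ B.CStar} (hM : IsClosed (M : Set B.CStar))
    (h : ∀ g b, B.canon g b ∈ M) (x : B.CStar) : x ∈ M := by
  refine mem_of_generators ?_ ?_ hM ?_ x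
  · rintro _ ⟨g, b, rfl⟩ _ ⟨h, c, rfl⟩
    exact ⟨g * h, B.mul rfl b c, (B.univ_mul rfl b c).symm⟩
  · rintro _ ⟨g, b, rfl⟩
    exact ⟨g⁻¹, B.adj rfl b, (B.univ_adj rfl b).symm⟩
  · rintro _ ⟨g, b, rfl⟩
    exact h g b

end FellBundle

/-! ### The twisted family and the gauge action in C⋆(B(σ)) -/

namespace KGraph

variable {k : ℕ} {Λ : KGraph.{u} k} (hΛ : Λ.RowFinite) {G : Type w} [Group G]
  (η : Λ.Obj ⥤ SingleObj G) (σ : TwoCocycle G)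

/-- The C⋆-algebra of the deformed Fell bundle of a `k`-graph. -/
abbrev DeformedCStar : Type (max (u + 2) (w + 1)) := ((Λ.fellBundle hΛ η).deform σ).CStar

/-- The image in the C⋆-algebra of the deformed bundle of an element of the fibre over `g`. -/
def deformedImage (g : G) (x : (Λ.canonicalFamily hΛ).spectralSubspace η g) :
    DeformedCStar hΛ η σ :=
  ((Λ.fellBundle hΛ η).deform σ).canon g x

theorem deformedImage_mul {g h l : G} (e : g * h = l)
    (x : (Λ.canonicalFamily hΛ).spectralSubspace η g)
    (y : (Λ.canonicalFamily hΛ).spectralSubspace η h) :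
    deformedImage hΛ η σ g x * deformedImage hΛ η σ h y = (σ.toFun g h : ℂ) •
      deformedImage hΛ η σ l ⟨x.1 * y.1, (Λ.canonicalFamily hΛ).mul_mem η hΛ e x.2 y.2⟩ := by
  refine (((Λ.fellBundle hΛ η).deform σ).canon_mul e x y).symm.trans ?_
  exact map_smul (((Λ.fellBundle hΛ η).deform σ).canon l) _ _

theorem star_deformedImage {g h : G} (e : g⁻¹ = h)
    (x : (Λ.canonicalFamily hΛ).spectralSubspace η g) :
    star (deformedImage hΛ η σ g x) = conj (σ.toFun g g⁻¹ : ℂ) •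
      deformedImage hΛ η σ h ⟨star x.1, (Λ.canonicalFamily hΛ).star_mem η e x.2⟩ := by
  refine (((Λ.fellBundle hΛ η).deform σ).canon_adj e x).symm.trans ?_
  exact map_smul (((Λ.fellBundle hΛ η).deform σ).canon h) _ _

theorem deformedImage_congr {g h : G} (e : g = h)
    {x : (Λ.canonicalFamily hΛ).spectralSubspace η g}
    {y : (Λ.canonicalFamily hΛ).spectralSubspace η h} (hxy : x.1 = y.1) :
    deformedImage hΛ η σ g x = deformedImage hΛ η σ h y := by
  subst e
  rw [Subtype.ext hxy]

theorem deformedImage_eq_zero {g : G}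
    {x : (Λ.canonicalFamily hΛ).spectralSubspace η g} (hx : x.1 = 0) :
    deformedImage hΛ η σ g x = 0 := by
  rw [show x = 0 from Subtype.ext hx]
  exact map_zero (((Λ.fellBundle hΛ η).deform σ).canon g)

theorem star_deformedImage_mul {g h l : G} (e : g⁻¹ * h = l)
    (x : (Λ.canonicalFamily hΛ).spectralSubspace η g)
    (y : (Λ.canonicalFamily hΛ).spectralSubspace η h) :
    star (deformedImage hΛ η σ g x) * deformedImage hΛ η σ h y =
      (conj (σ.toFun g g⁻¹ : ℂ) * σ.toFun g⁻¹ h) • deformedImage hΛ η σ l ⟨star x.1 * y.1,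
        (Λ.canonicalFamily hΛ).mul_mem η hΛ e
          ((Λ.canonicalFamily hΛ).star_mem η rfl x.2) y.2⟩ := by
  rw [star_deformedImage hΛ η σ rfl, smul_mul_assoc, deformedImage_mul hΛ η σ e, smul_smul]

theorem deformedImage_mul_star {g h l : G} (e : g * h⁻¹ = l)
    (x : (Λ.canonicalFamily hΛ).spectralSubspace η g)
    (y : (Λ.canonicalFamily hΛ).spectralSubspace η h) :
    deformedImage hΛ η σ g x * star (deformedImage hΛ η σ h y) =
      (conj (σ.toFun h h⁻¹ : ℂ) * σ.toFun g h⁻¹) • deformedImage hΛ η σ l ⟨x.1 * star y.1,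
        (Λ.canonicalFamily hΛ).mul_mem η hΛ e x.2
          ((Λ.canonicalFamily hΛ).star_mem η rfl y.2)⟩ := by
  rw [star_deformedImage hΛ η σ rfl, mul_smul_comm, deformedImage_mul hΛ η σ e, smul_smul]

theorem conj_coe_mul_self (z : Circle) : conj (z : ℂ) * z = 1 := by
  rw [Complex.conj_mul', Circle.norm_coe]
  simp

theorem gen_mem {a b : Λ.Obj} (f : a ⟶ b) :
    Λ.gen f ∈ (Λ.canonicalFamily hΛ).spectralSubspace η (label η f) := by
  refine Submodule.le_topologicalClosure _ (Submodule.subset_span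
    ⟨a, b, a, a, f, 𝟙 a, by rw [label_id, inv_one, mul_one], ?_⟩)
  rw [((Λ.canonicalFamily hΛ).proj a).isSelfAdjoint.star_eq]
  exact ((Λ.canonicalFamily hΛ).mul_id f).symm

/-- The image of the generator `s_f` in the C⋆-algebra of the deformed bundle. -/
def deformedGen {a b : Λ.Obj} (f : a ⟶ b) : DeformedCStar hΛ η σ :=
  deformedImage hΛ η σ (label η f) ⟨Λ.gen f, gen_mem hΛ η f⟩

theorem deformedGen_mul_star {a b c d : Λ.Obj} (f : a ⟶ b) (f' : c ⟶ d) {g : G}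
    (h : label η f * (label η f')⁻¹ = g) :
    deformedGen hΛ η σ f * star (deformedGen hΛ η σ f') =
      (conj (σ.toFun (label η f') (label η f')⁻¹ : ℂ) *
        σ.toFun (label η f) (label η f')⁻¹) • deformedImage hΛ η σ g (mono hΛ η f f' h) :=
  deformedImage_mul_star hΛ η σ h _ _

/-- The generators of `C⋆(Λ)` become a twisted Cuntz–Krieger family after deformation. -/
def deformedFamily : TwistedFamily Λ (DeformedCStar hΛ η σ) where
  toFun := deformedGen hΛ η σ
  star_id v := by
    have e : (label η (𝟙 v))⁻¹ = label η (𝟙 v) := by rw [label_id, inv_one]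
    rw [deformedGen, star_deformedImage hΛ η σ e]
    simp only [label_id, σ.one_left, Circle.coe_one, map_one, one_smul]
    exact deformedImage_congr hΛ η σ rfl ((Λ.canonicalFamily hΛ).proj v).isSelfAdjoint.star_eq
  mul_id {u v} f := by
    have e : label η f * label η (𝟙 u) = label η f := by rw [label_id, mul_one]
    have hσ : σ.toFun (label η f) (label η (𝟙 u)) = 1 := by rw [label_id, σ.one_right]
    rw [deformedGen, deformedGen, deformedImage_mul hΛ η σ e, hσ, Circle.coe_one, one_smul]
    exact deformedImage_congr hΛ η σ rfl ((Λ.canonicalFamily hΛ).mul_id f)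
  id_mul {u v} f := by
    have e : label η (𝟙 v) * label η f = label η f := by rw [label_id, one_mul]
    have hσ : σ.toFun (label η (𝟙 v)) (label η f) = 1 := by rw [label_id, σ.one_left]
    rw [deformedGen, deformedGen, deformedImage_mul hΛ η σ e, hσ, Circle.coe_one, one_smul]
    exact deformedImage_congr hΛ η σ rfl ((Λ.canonicalFamily hΛ).id_mul f)
  comp f g := by
    refine ⟨σ.toFun (label η g) (label η f), Circle.norm_coe _, ?_⟩
    rw [deformedGen, deformedGen, deformedImage_mul hΛ η σ (label_comp η f g).symm]
    congr 1
    exact deformedImage_congr hΛ η σ rfl ((Λ.canonicalFamily hΛ).comp f g)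
  star_mul_self {u v} f := by
    have e : (label η f)⁻¹ * label η f = label η (𝟙 u) := by rw [label_id, inv_mul_cancel]
    -- With g = η(f), the conjugate of σ(g,g⁻¹) from the adjoint cancels σ(g⁻¹,g) from the product,
    -- by `inv_symm`.
    rw [deformedGen, star_deformedImage_mul hΛ η σ e, σ.inv_symm, conj_coe_mul_self, one_smul]
    exact deformedImage_congr hΛ η σ rfl ((Λ.canonicalFamily hΛ).star_mul_self f)
  star_mul_eq_zero f g h := by
    rw [deformedGen, deformedGen, star_deformedImage_mul hΛ η σ rfl, deformedImage_eq_zero,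
      smul_zero]
    exact (Λ.canonicalFamily hΛ).star_mul_eq_zero f g h
  star_mul_of_ne x y h := by
    rw [deformedGen, deformedGen, star_deformedImage_mul hΛ η σ rfl, deformedImage_eq_zero,
      smul_zero]
    exact (Λ.canonicalFamily hΛ).star_mul_of_ne hΛ x y h
  sum w n := by
    have := hΛ w n
    have := Fintype.ofFinite (Λ.PathsTo w n)
    have hs := (Λ.canonicalFamily hΛ).sum w n
    rw [finsum_eq_sum_of_fintype] at hs ⊢
    have e : ∀ x : Λ.PathsTo w n,
        label η x.1.2 * (label η x.1.2)⁻¹ = label η (𝟙 w) := fun x => by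
      rw [label_id, mul_inv_cancel]
    -- The phase in t_x t_x⋆ cancels as well, so the undeformed sum in the unit fibre carries over.
    have h1 : ∀ x : Λ.PathsTo w n,
        deformedGen hΛ η σ x.1.2 * star (deformedGen hΛ η σ x.1.2) =
          deformedImage hΛ η σ (label η (𝟙 w)) (mono hΛ η x.1.2 x.1.2 (e x)) := fun x => by
      rw [deformedGen_mul_star hΛ η σ x.1.2 x.1.2 (e x), conj_coe_mul_self, one_smul]
    rw [Finset.sum_congr rfl fun x _ => h1 x]
    refine Eq.trans (congrArg (deformedImage hΛ η σ (label η (𝟙 w))) (Subtype.ext ?_)) (map_sum (((Λ.fellBundle hΛ η).deform σ).canon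
      (label η (𝟙 w))) (fun x : Λ.PathsTo w n => mono hΛ η x.1.2 x.1.2 (e x)) Finset.univ)
    refine hs.trans ?_
    exact (map_sum (Submodule.subtype ((Λ.canonicalFamily hΛ).spectralSubspace η
      (label η (𝟙 w)))) (fun x : Λ.PathsTo w n => mono hΛ η x.1.2 x.1.2 (e x)) Finset.univ).symm

theorem deformedImage_mono_mem {a b c d : Λ.Obj} (f : a ⟶ b) (f' : c ⟶ d) {g : G}
    (h : label η f * (label η f')⁻¹ = g) :
    deformedImage hΛ η σ g (mono hΛ η f f' h) ∈ (deformedFamily hΛ η σ).polynomials := by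
  have h1 := deformedGen_mul_star hΛ η σ f f' h
  set z := conj (σ.toFun (label η f') (label η f')⁻¹ : ℂ) *
        σ.toFun (label η f) (label η f')⁻¹ with hz
  have hz0 : z ≠ 0 := by
    rw [hz]
    exact mul_ne_zero (by simp) (Circle.coe_ne_zero _)
  have h2 : deformedImage hΛ η σ g (mono hΛ η f f' h) =
      z⁻¹ • (deformedGen hΛ η σ f * star (deformedGen hΛ η σ f')) := by
    rw [h1, smul_smul, inv_mul_cancel₀ hz0, one_smul]
  rw [h2]
  refine Submodule.smul_mem _ _ ?_
  -- Bidegrees only involve pairs with a common source; for different sources the product is zero.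
  by_cases hac : a = c
  · subst hac
    exact (deformedFamily hΛ η σ).mem_polynomials ((deformedFamily hΛ η σ).bidegree_mem f f')
  · have : deformedGen hΛ η σ f * star (deformedGen hΛ η σ f') = 0 :=
      (deformedFamily hΛ η σ).mul_star_eq_zero f f' hac
    rw [this]
    exact Submodule.zero_mem _

theorem closure_polynomials_eq_top :
    (deformedFamily hΛ η σ).polynomials.topologicalClosure = ⊤ := by
  refine eq_top_iff.2 fun x _ => ?_
  refine ((Λ.fellBundle hΛ η).deform σ).mem_of_canon (Submodule.isClosed_topologicalClosure _)
    (fun g b => ?_) x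
  have hc : IsClosed (((deformedFamily hΛ η σ).polynomials.topologicalClosure.comap
      (((Λ.fellBundle hΛ η).deform σ).canon g) : Submodule ℂ ((Λ.fellBundle hΛ η).fiber g)) :
        Set ((Λ.fellBundle hΛ η).fiber g)) :=
    (Submodule.isClosed_topologicalClosure _).preimage
      (((Λ.fellBundle hΛ η).deform σ).continuous_canon g)
  refine fiber_mem_of_mono hΛ η hc (fun f f' h => ?_) b
  exact Submodule.le_topologicalClosure _ (deformedImage_mono_mem hΛ η σ f f' h)

/-- The gauge action on the C⋆-algebra of the deformed bundle. -/
def deformedGauge (z : Fin k → Circle) : DeformedCStar hΛ η σ →⋆ₙₐ[ℂ] DeformedCStar hΛ η σ :=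
  restrictGenerated
    (lpReindex (fun ρ : FellBundle.RepInto ((Λ.fellBundle hΛ η).deform σ) =>
      { alg := ρ.alg, rep := gaugeRep hΛ η σ ρ.rep z })
      fun ρ => NonUnitalStarAlgHom.id ℂ ρ.alg) (by
    rintro _ ⟨g, b, rfl⟩
    exact subset_generatedCStar _ ⟨g, gaugeFiber hΛ η z g b, rfl⟩)

theorem deformedGauge_deformedGen_mul_star (z : Fin k → Circle) {a b c : Λ.Obj} (f : a ⟶ b)
    (f' : a ⟶ c) :
    deformedGauge hΛ η σ z (deformedGen hΛ η σ f * star (deformedGen hΛ η σ f')) =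
      (gaugeChar (Λ.deg f) (Λ.deg f') z : ℂ) •
        (deformedGen hΛ η σ f * star (deformedGen hΛ η σ f')) := by
  have h1 : gaugeFiber hΛ η z _ (mono hΛ η f f' rfl) =
      (gaugeChar (Λ.deg f) (Λ.deg f') z : ℂ) • mono hΛ η f f' rfl :=
    Subtype.ext (gaugeHom_gen_mul_star z f f')
  have h2 : deformedGauge hΛ η σ z (deformedImage hΛ η σ _ (mono hΛ η f f' rfl)) =
      (gaugeChar (Λ.deg f) (Λ.deg f') z : ℂ) • deformedImage hΛ η σ _ (mono hΛ η f f' rfl) := by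
    refine Eq.trans (b := deformedImage hΛ η σ _ (gaugeFiber hΛ η z _ (mono hΛ η f f' rfl))) rfl ?_
    rw [h1]
    exact map_smul (((Λ.fellBundle hΛ η).deform σ).canon _) _ _
  rw [deformedGen_mul_star hΛ η σ f f' rfl, map_smul, h2, smul_comm]

end KGraph

/-! ### A nonzero representation of the deformed bundle -/

namespace FellBundle

variable {G : Type w} [Group G] (B : FellBundle.{v} G) {D : Type u} [NonUnitalCStarAlgebra D]

/-- A compatible family of maps of the fibres of a Fell bundle into a C⋆-algebra is a
representation in the C⋆-subalgebra that their images generate. -/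
def repOfOperators (φ : ∀ g, B.fiber g →ₗ[ℂ] D) (hc : ∀ g, Continuous (φ g))
    (hmul : ∀ {g h k : G} (e : g * h = k) (b : B.fiber g) (c : B.fiber h),
      φ k (B.mul e b c) = φ g b * φ h c)
    (hadj : ∀ {g h : G} (e : g⁻¹ = h) (b : B.fiber g), φ h (B.adj e b) = star (φ g b))
    (hB : ∀ g (b : B.fiber g), b ∈ (Submodule.span ℂ {x | ∃ c d,
      x = B.mul (one_mul g) c d}).topologicalClosure) :
    Rep B (generatedCStar {y | ∃ (g : G) (b : B.fiber g), y = φ g b}) where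
  toFun g :=
    { toFun := fun b => ⟨φ g b, subset_generatedCStar _ ⟨g, b, rfl⟩⟩
      map_add' := fun b c => Subtype.ext (map_add (φ g) b c)
      map_smul' := fun z b => Subtype.ext (map_smul (φ g) z b) }
  map_mul e b c := Subtype.ext (hmul e b c)
  map_adj e b := Subtype.ext (hadj e b)
  nondegenerate := by
    refine eq_top_iff.2 fun x _ => mem_of_generators ?_ ?_
      (Submodule.isClosed_topologicalClosure _) ?_ x
    · rintro _ ⟨g, b, rfl⟩ _ ⟨h, c, rfl⟩
      exact ⟨g * h, _, (hmul rfl b c).symm⟩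
    · rintro _ ⟨g, b, rfl⟩
      exact ⟨g⁻¹, _, (hadj rfl b).symm⟩
    · rintro _ ⟨g, b, rfl⟩
      let ψ : B.fiber g →ₗ[ℂ] generatedCStar {y | ∃ (g : G) (b : B.fiber g), y = φ g b} :=
        { toFun := fun b => ⟨φ g b, subset_generatedCStar _ ⟨g, b, rfl⟩⟩
          map_add' := fun b c => Subtype.ext (map_add (φ g) b c)
          map_smul' := fun z b => Subtype.ext (map_smul (φ g) z b) }
      have hψ : Continuous ψ := (hc g).subtype_mk _
      -- By `hB`, b is a limit of sums of products cd with c in the unit fibre, whose images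
      -- φ(c)φ(d) have the form that nondegeneracy asks for.
      refine map_mem_closure (f := ψ) hψ (hB g b) fun y hy => ?_
      change y ∈ Submodule.span ℂ _ at hy
      change ψ y ∈ Submodule.span ℂ _
      induction hy using Submodule.span_induction with
      | mem y hy =>
        obtain ⟨c, d, rfl⟩ := hy
        exact Submodule.subset_span ⟨c, ψ d, Subtype.ext (hmul (one_mul g) c d)⟩
      | zero =>
        rw [map_zero]
        exact Submodule.zero_mem _
      | add y z _ _ hy hz =>
        rw [map_add]
        exact Submodule.add_mem _ hy hz
      | smul z y _ hy =>
        rw [map_smul]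
        exact Submodule.smul_mem _ z hy

end FellBundle

namespace KGraph

variable {k : ℕ} {Λ : KGraph.{u} k} (hΛ : Λ.RowFinite) {G : Type w} [Group G]
  (η : Λ.Obj ⥤ SingleObj G) (σ : TwoCocycle G)

/-- The representation of `C⋆(Λ)` given by a Cuntz–Krieger family. -/
def evalFamily {A : Type u} [NonUnitalCStarAlgebra A] (T : CKFamily Λ A) : Λ.CStar →⋆ₙₐ[ℂ] A where
  toFun x := x.1.1 (⟨A, T⟩ : CKInto Λ)
  map_smul' _ _ := rfl
  map_zero' := rfl
  map_add' _ _ := rfl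
  map_mul' _ _ := rfl
  map_star' _ := rfl

variable {X : Type u} (T : CKFamily Λ (lp (fun _ : X => ℂ) 2 →L[ℂ] lp (fun _ : X => ℂ) 2))

/-- The operators on `ℓ²(G × X)` by which the deformed bundle acts. -/
def regularOp (g : G) : ((Λ.fellBundle hΛ η).deform σ).fiber g →ₗ[ℂ]
    (lp (fun _ : ULift.{u + 1} G => lp (fun _ : X => ℂ) 2) 2 →L[ℂ]
      lp (fun _ : ULift.{u + 1} G => lp (fun _ : X => ℂ) 2) 2) where
  toFun b := amplify σ (evalFamily T b.1) g
  map_add' b c := (congrArg (amplify σ · g) (map_add (evalFamily T) b.1 c.1)).trans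
    (amplify_add σ _ _ g)
  map_smul' z b := (congrArg (amplify σ · g) (map_smul (evalFamily T) z b.1)).trans
    (amplify_smul σ z _ g)

theorem regularOp_mul {g h l : G} (e : g * h = l) (b : ((Λ.fellBundle hΛ η).deform σ).fiber g)
    (c : ((Λ.fellBundle hΛ η).deform σ).fiber h) :
    regularOp hΛ η σ T l (((Λ.fellBundle hΛ η).deform σ).mul e b c) =
      regularOp hΛ η σ T g b * regularOp hΛ η σ T h c := by
  subst e
  refine Eq.trans ?_ (amplify_mul_amplify σ (evalFamily T b.1) (evalFamily T c.1) g h).symm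
  rw [← map_mul (evalFamily T), ← amplify_smul, ← map_smul]
  rfl

theorem regularOp_adj {g h : G} (e : g⁻¹ = h) (b : ((Λ.fellBundle hΛ η).deform σ).fiber g) :
    regularOp hΛ η σ T h (((Λ.fellBundle hΛ η).deform σ).adj e b) =
      star (regularOp hΛ η σ T g b) := by
  subst e
  refine Eq.trans ?_ (star_amplify σ (evalFamily T b.1) g).symm
  rw [← map_star (evalFamily T), ← amplify_smul, ← map_smul]
  rfl

theorem continuous_regularOp (g : G) : Continuous (regularOp hΛ η σ T g) :=
  AddMonoidHomClass.continuous_of_bound (regularOp hΛ η σ T g) 1 fun b => by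
    rw [one_mul]
    exact (norm_amplify_le σ _ g).trans (NonUnitalStarAlgHom.norm_apply_le (evalFamily T) b.1)

theorem mul_mono {a b c d : Λ.Obj} (f : a ⟶ b) (f' : c ⟶ d) {g : G}
    (h : label η f * (label η f')⁻¹ = g) (e : label η (𝟙 b) * (label η (𝟙 b))⁻¹ = 1) :
    ((Λ.fellBundle hΛ η).deform σ).mul (one_mul g) (mono hΛ η (𝟙 b) (𝟙 b) e) (mono hΛ η f f' h) =
      mono hΛ η f f' h := by
  refine Subtype.ext ?_
  change (σ.toFun 1 g : ℂ) • (Λ.gen (𝟙 b) * star (Λ.gen (𝟙 b)) * (Λ.gen f * star (Λ.gen f'))) =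
    Λ.gen f * star (Λ.gen f')
  have h1 : Λ.gen (𝟙 b) * star (Λ.gen (𝟙 b)) = Λ.gen (𝟙 b) := by
    have h0 : star (Λ.gen (𝟙 b)) = Λ.gen (𝟙 b) :=
      ((Λ.canonicalFamily hΛ).proj b).isSelfAdjoint.star_eq
    rw [h0]
    exact (Λ.canonicalFamily hΛ).mul_id (𝟙 b)
  have h2 : Λ.gen (𝟙 b) * Λ.gen f = Λ.gen f := (Λ.canonicalFamily hΛ).id_mul f
  rw [σ.one_left, Circle.coe_one, one_smul, h1, ← mul_assoc, h2]

theorem deform_fiber_mem_of_mono {g : G}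
    {M : Submodule ℂ (((Λ.fellBundle hΛ η).deform σ).fiber g)}
    (hM : IsClosed (M : Set (((Λ.fellBundle hΛ η).deform σ).fiber g)))
    (h : ∀ {a b c d : Λ.Obj} (f : a ⟶ b) (f' : c ⟶ d) (h : label η f * (label η f')⁻¹ = g),
      mono hΛ η f f' h ∈ M) (b : ((Λ.fellBundle hΛ η).deform σ).fiber g) : b ∈ M :=
  fiber_mem_of_mono hΛ η hM h b

/-- The vertex projection at r(f) lies in the unit fibre and is a left unit for s_f s_f'⋆, also
after deformation because σ(1,g) = 1. -/
theorem unit_mul_dense (g : G) (b : ((Λ.fellBundle hΛ η).deform σ).fiber g) :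
    b ∈ (Submodule.span ℂ {x | ∃ c d,
      x = ((Λ.fellBundle hΛ η).deform σ).mul (one_mul g) c d}).topologicalClosure := by
  let M : Submodule ℂ (((Λ.fellBundle hΛ η).deform σ).fiber g) :=
    (Submodule.span ℂ {x | ∃ c d,
      x = ((Λ.fellBundle hΛ η).deform σ).mul (one_mul g) c d}).topologicalClosure
  have hM : IsClosed (M : Set (((Λ.fellBundle hΛ η).deform σ).fiber g)) :=
    Submodule.isClosed_topologicalClosure _
  have h1 : ∀ c d, ((Λ.fellBundle hΛ η).deform σ).mul (one_mul g) c d ∈ M := fun c d =>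
    Submodule.le_topologicalClosure _ (Submodule.subset_span ⟨c, d, rfl⟩)
  refine deform_fiber_mem_of_mono hΛ η σ hM (fun {p q r s} f f' h => ?_) b
  have e : label η (𝟙 q) * (label η (𝟙 q))⁻¹ = 1 := mul_inv_cancel _
  have h2 := h1 (mono hΛ η (𝟙 q) (𝟙 q) e) (mono hΛ η f f' h)
  rwa [mul_mono hΛ η σ f f' h e] at h2

/-- The regular representation of the deformed bundle that comes from a Cuntz–Krieger family of
operators on `ℓ²(X)`. -/
def regularRep : FellBundle.Rep ((Λ.fellBundle hΛ η).deform σ)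
    (generatedCStar {y | ∃ (g : G) (b : ((Λ.fellBundle hΛ η).deform σ).fiber g),
      y = regularOp hΛ η σ T g b}) :=
  FellBundle.repOfOperators ((Λ.fellBundle hΛ η).deform σ) (regularOp hΛ η σ T)
    (continuous_regularOp hΛ η σ T) (regularOp_mul hΛ η σ T) (regularOp_adj hΛ η σ T)
    (unit_mul_dense hΛ η σ)

theorem nontrivial_deformedCStar (hns : Λ.NoSources) [Nonempty Λ.Obj] :
    Nontrivial (DeformedCStar hΛ η σ) := by
  obtain ⟨X, T, v, hv⟩ := exists_family_id_ne_zero hΛ hns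
  have e : label η (𝟙 v) * (label η (𝟙 v))⁻¹ = 1 := mul_inv_cancel _
  refine ⟨((Λ.fellBundle hΛ η).deform σ).canon 1 (mono hΛ η (𝟙 v) (𝟙 v) e), 0, fun h => ?_⟩
  let ρ : FellBundle.RepInto ((Λ.fellBundle hΛ η).deform σ) := ⟨_, regularRep hΛ η σ T⟩
  have h1 : ρ.rep.toFun 1 (mono hΛ η (𝟙 v) (𝟙 v) e) = 0 :=
    congrArg (fun x : DeformedCStar hΛ η σ => x.1.1 ρ) h
  -- The lift of G to this universe places the regular representation among those that define the
  -- universal algebra.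
  refine amplify_one_ne_zero.{u, u + 1} σ
    (T := evalFamily T (mono hΛ η (𝟙 v) (𝟙 v) e).1) ?_ (congrArg Subtype.val h1)
  change T.toFun (𝟙 v) * star (T.toFun (𝟙 v)) ≠ 0
  rwa [(T.proj v).isSelfAdjoint.star_eq, T.mul_id]

end KGraph

end

theorem mainTheorem6 {k : ℕ} (Λ : KGraph.{u} k) [Nonempty Λ.Obj]
    (hrf : Λ.RowFinite) (hns : Λ.NoSources) (hap : Λ.Aperiodic) (hcof : Λ.Cofinal)
    {G : Type w} [Group G] (η : Λ.Obj ⥤ SingleObj G) (σ : TwoCocycle G) :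
    IsSimpleCStarAlgebra ((Λ.fellBundle hrf η).deform σ).CStar := by
  have := KGraph.nontrivial_deformedCStar hrf η σ hns
  exact (KGraph.deformedFamily hrf η σ).isSimple hrf hap hcof
    (KGraph.closure_polynomials_eq_top hrf η σ)
    (KGraph.deformedGauge_deformedGen_mul_star hrf η σ)
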